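/- **Notation.** Fix an integer $n\ge 1$. Let $\mathbb F_n^+$ be the free semigroup with unit $\emptyset$ on the generators $1,\dots,n$; its elements are words, $\tilde w=i_k\cdots i_1$ is the reverse of $w=i_1\cdots i_k$, and $A_w=A_{i_1}\cdots A_{i_k}$ ($A_\emptyset=I$) for operators $A_1,\dots,A_n$. Let $\mathfrak F=\bigoplus_{k\ge0}(\mathbb C^n)^{\otimes k}$ be the full Fock space, with orthonormal basis $(e_w)_{w\in\mathbb F_n^+}$, and $L_i\xi=e_i\otimes\xi$, $R_i\xi=\xi\otimes e_i$ the left and right creation operators. Let $\mathfrak l_n$ and $\mathfrak L_n$ be the closures of the unital algebra generated by $L_1,\dots,L_n$ in the norm and in the weak operator topology. For $\zeta\in\mathbb C^n$ put $L[\zeta]=\sum_i\zeta_iL_i$. *Row contractions.* Let $\mathcal H$ be a complex Hilbert space. A row contraction $T=(T_1,\dots,T_n)$ consists of bounded operators on $\mathcal H$ (not assumed to commute) with $\sum_iT_iT_i^*\le I$; it is also regarded as the contraction $T:\mathcal H^n\to\mathcal H$, $T(h_1,\dots,h_n)=\sum_iT_ih_i$. Let $D_T=(I-T^*T)^{1/2}$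 on $\mathcal H^n$, $D_{T^*}=(I-TT^*)^{1/2}$ on $\mathcal H$, $\mathcal D_T=\overline{D_T\mathcal H^n}$, $\mathcal D_{T^*}=\overline{D_{T^*}\mathcal H}$. Let $\rho_T:\mathfrak l_n\to\mathcal L(\mathcal H)$ be the unique completely contractive unital homomorphism with $\rho_T(L_i)=T_i$. The Poisson kernel is $$K_T:\mathcal H\to\mathfrak F\otimes\mathcal D_{T^*},\qquad K_Th=\sum_{w}e_w\otimes D_{T^*}T_w^*h .$$ A bounded operator $M:\mathfrak F\otimes\mathcal E\to\mathfrak F\otimes\mathcal E_*$ is multianalytic if $M(L_i\otimes I)=(L_i\otimes I)M$ for all $i$; it is determined by its coefficients $m_w:\mathcal E\to\mathcal E_*$, $\langle m_{\tilde w}k,k_*\rangle=\langle M(e_\emptyset\otimes k),e_w\otimes k_*\rangle$, and one writes $M\sim\sum_wR_w\otimes m_w$. The characteristic function is the multianalytic operator $\Theta_T:\mathfrak F\otimes\mathcal D_T\to\mathfrak F\otimes\mathcal D_{T^*}$ with the formal expansion $$-I\otimes T+(I\otimes D_{T^*})\Bigl(I-\sum_iR_i\otimes T_i^*\Bigr)^{-1}[R_1\otimes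 I,\dots,R_n\otimes I](I\otimes D_T)\Big|_{\mathfrak F\otimes\mathcal D_T},$$ that is, with coefficients $m_\emptyset=-T|_{\mathcal D_T}$ and $m_{vj}=D_{T^*}T_{i_1}^*\cdots T_{i_k}^*P_jD_T|_{\mathcal D_T}$ for $v=i_1\cdots i_k\in\mathbb F_n^+$ and $1\le j\le n$, where $P_j:\mathcal H^n\to\mathcal H$ is the $j$-th coordinate. *Voiculescu automorphisms.* Let $U(1,n)$ be the group of complex $(n+1)\times(n+1)$ matrices $X$ with $X^*JX=J$, $J=\operatorname{diag}(-1,1,\dots,1)$, and write $X=\begin{pmatrix}x&y\\ z^t&X'\end{pmatrix}$ with $x\in\mathbb C$ and rows $y,z\in\mathbb C^n$. For $X\in U(1,n)$ there are a unique automorphism $\Phi_X$ of the algebra $\mathfrak L_n$ and a unique unitary $U_X$ on $\mathfrak F$ with $$\Phi_X(L[\zeta])=(xI-L[z])^{-1}\bigl(L[X'\zeta]-(\textstyle\sum_i\zeta_iy_i)I\bigr)\quad(\zeta\in\mathbb C^n),$$ $$U_X(Ae_\emptyset)=\Phi_X(A)(xI-L[z])^{-1}e_\emptyset,\qquad \Phi_X(A)=U_XAU_X^*\quad(A\in\mathfrak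 L_n).$$ The operators $\Phi_X^{-1}(L_i)$ belong to $\mathfrak l_n$, and $\Phi_X^{-1}(T)=\bigl(\rho_T(\Phi_X^{-1}(L_1)),\dots,\rho_T(\Phi_X^{-1}(L_n))\bigr)$ is again a row contraction. **Theorem.** Let $T=(T_1,\dots,T_n)$ be a row contraction on a complex Hilbert space $\mathcal H$ and let $X\in U(1,n)$. Then there exist unitary operators $Z:\mathcal D_{\Phi_X^{-1}(T)}\to\mathcal D_T$ and $Z_*:\mathcal D_{\Phi_X^{-1}(T)^*}\to\mathcal D_{T^*}$ such that (i) $\Theta_{\Phi_X^{-1}(T)}=(U_X\otimes Z_*^*)\,\Theta_T\,(U_X^*\otimes Z)$, and (ii) $K_{\Phi_X^{-1}(T)}=(U_X\otimes Z_*^*)\,K_T$. -/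

import Mathlib

open scoped InnerProductSpace
open ContinuousLinearMap (adjoint)

set_option linter.unusedSectionVars false
set_option linter.unusedSimpArgs false

namespace RowContr

/-- Words in the letters `0, …, n-1`: the free semigroup with unit on `n` generators. Multiplication is
concatenation and `1` is the empty word. -/
abbrev Word (n : ℕ) := FreeMonoid (Fin n)

instance (n : ℕ) : DecidableEq (Word n) := inferInstanceAs (DecidableEq (List (Fin n)))

section Fock

variable {n : ℕ} {E E' : Type*}
  [NormedAddCommGroup E] [InnerProductSpace ℂ E]
  [NormedAddCommGroup E'] [InnerProductSpace ℂ E']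

/-- The Hilbert space tensor product of the full Fock space on `n` generators with `E`, realized as the
space of square summable families of vectors of `E` indexed by words: the family `u` stands for
`∑_w e_w ⊗ u_w`. -/
noncomputable abbrev FockTensor (n : ℕ) (E : Type*) [NormedAddCommGroup E] : Type _ := lp (fun _ : Word n => E) 2

/-- The full Fock space, with orthonormal basis `e_w` indexed by the words. -/
noncomputable abbrev Fock (n : ℕ) := FockTensor n ℂ

/-- The basis vector `e_w`; in particular `basisVec 1` is the vacuum vector. -/
noncomputable def basisVec (w : Word n) : Fock n := lp.single 2 w 1

/-- The elementary tensor `ξ ⊗ h`. -/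
noncomputable def tmul (ξ : Fock n) (h : E) : FockTensor n E :=
  ⟨fun w => ξ w • h, by
    have h1 := (memℓp_norm_iff.2 (lp.memℓp ξ)).const_mul ‖h‖
    exact Memℓp.mono' h1 fun w => by simp [norm_smul, mul_comm]⟩

@[simp] theorem tmul_apply (ξ : Fock n) (h : E) (w : Word n) : tmul ξ h w = ξ w • h := rfl

theorem inner_tmul (ξ η : Fock n) (h k : E) : ⟪tmul ξ h, tmul η k⟫_ℂ = ⟪ξ, η⟫_ℂ * ⟪h, k⟫_ℂ := by
  rw [lp.inner_eq_tsum, lp.inner_eq_tsum, ← tsum_mul_right]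
  refine tsum_congr fun w => ?_
  simp [inner_smul_left, inner_smul_right]
  ring

theorem norm_tmul (ξ : Fock n) (h : E) : ‖tmul ξ h‖ = ‖ξ‖ * ‖h‖ := by
  have := inner_tmul ξ ξ h h
  simp only [inner_self_eq_norm_sq_to_K] at this
  have h2 : ‖tmul ξ h‖ ^ 2 = (‖ξ‖ * ‖h‖) ^ 2 := by
    rw [mul_pow]; exact_mod_cast this
  exact (sq_eq_sq₀ (norm_nonneg _) (by positivity)).1 h2

theorem tmul_basisVec (w : Word n) (h : E) : tmul (basisVec w) h = lp.single 2 w h := by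
  refine lp.ext (funext fun v => ?_)
  by_cases hv : v = w
  · subst hv; simp [basisVec]
  · simp [basisVec, hv]

/-- The operator `h ↦ ξ ⊗ h`. -/
noncomputable def tmulRight (ξ : Fock n) : E →ₗ[ℂ] FockTensor n E where
  toFun := tmul ξ
  map_add' h k := by refine lp.ext (funext fun v => ?_); simp
  map_smul' c h := by refine lp.ext (funext fun v => ?_); simp [smul_smul, mul_comm]

/-- The operator `ξ ↦ ξ ⊗ h`. -/
noncomputable def tmulLeft (h : E) : Fock n →L[ℂ] FockTensor n E :=
  LinearMap.mkContinuous
    { toFun := fun ξ => tmul ξ h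
      map_add' := fun ξ η => by refine lp.ext (funext fun v => ?_); simp [add_smul]
      map_smul' := fun c ξ => by refine lp.ext (funext fun v => ?_); simp [smul_smul] }
    ‖h‖ (fun ξ => by simp [norm_tmul, mul_comm])

theorem inner_basisVec (v w : Word n) :
    ⟪(basisVec v : Fock n), basisVec w⟫_ℂ = if v = w then 1 else 0 := by
  rw [basisVec, lp.inner_single_left]
  by_cases hv : v = w
  · subst hv; simp [basisVec]
  · simp [basisVec, hv]

theorem tensorFamily_aux (U : Fock n →ₗᵢ[ℂ] Fock n) (Z : E →ₗᵢ[ℂ] E') (w : Word n) (h : E) :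
    ‖(tmulRight (U (basisVec w)) ∘ₗ Z.toLinearMap) h‖ = ‖h‖ := by
  have : ‖(basisVec w : Fock n)‖ = 1 := by simp [basisVec]
  simp [tmulRight, norm_tmul, this]

variable [CompleteSpace E']

/-- The operator `U ⊗ Z`, for isometries `U` and `Z`: it maps `ξ ⊗ h` to `U ξ ⊗ Z h`, see
`tensorMap_tmul`. -/
noncomputable def tensorMap (U : Fock n →ₗᵢ[ℂ] Fock n) (Z : E →ₗᵢ[ℂ] E') :
    FockTensor n E →L[ℂ] FockTensor n E' :=
  (OrthogonalFamily.linearIsometry (𝕜 := ℂ) (G := fun _ : Word n => E)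
    (V := fun w => ⟨tmulRight (U (basisVec w)) ∘ₗ Z.toLinearMap, tensorFamily_aux U Z w⟩) (by
      intro v w hvw h k
      simp [tmulRight, inner_tmul, inner_basisVec, hvw])).toContinuousLinearMap

theorem tensorMap_single (U : Fock n →ₗᵢ[ℂ] Fock n) (Z : E →ₗᵢ[ℂ] E') (w : Word n) (h : E) :
    tensorMap U Z (lp.single 2 w h) = tmul (U (basisVec w)) (Z h) := by
  simp [tensorMap, tmulRight]

theorem clm_ext {F : Type*} [NormedAddCommGroup F] [NormedSpace ℂ F]
    {A B : FockTensor n E →L[ℂ] F} (h : ∀ w x, A (lp.single 2 w x) = B (lp.single 2 w x)) :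
    A = B := by
  refine lp.ext_continuousLinearMap (by simp) fun w => ?_
  ext x
  exact h w x

theorem tensorMap_tmul (U : Fock n →ₗᵢ[ℂ] Fock n) (Z : E →ₗᵢ[ℂ] E') (ξ : Fock n) (h : E) :
    tensorMap U Z (tmul ξ h) = tmul (U ξ) (Z h) := by
  have : (tensorMap U Z) ∘L tmulLeft h = tmulLeft (Z h) ∘L U.toContinuousLinearMap := by
    refine clm_ext fun w x => ?_
    have hx : (lp.single 2 w x : Fock n) = x • basisVec w := by
      rw [basisVec, ← lp.single_smul]; simp
    rw [hx, map_smul, map_smul]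
    congr 1
    change tensorMap U Z (tmul (basisVec w) h) = tmul (U (basisVec w)) (Z h)
    rw [tmul_basisVec, tensorMap_single]
  exact congrArg (fun A => A ξ) this

/-- The left creation operator `ξ ↦ e_i ⊗ ξ`; it maps `e_w` to `e_{iw}`. -/
noncomputable def leftCreation (i : Fin n) : Fock n →ₗᵢ[ℂ] Fock n :=
  OrthogonalFamily.linearIsometry (𝕜 := ℂ) (G := fun _ : Word n => ℂ)
    (V := fun w => ⟨LinearMap.toSpanSingleton ℂ (Fock n) (basisVec (FreeMonoid.of i * w)), fun x => by
      simp [basisVec, norm_smul]⟩) (by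
      intro v w hvw h k
      simp [inner_smul_left, inner_smul_right, inner_basisVec, hvw])

theorem leftCreation_basisVec (i : Fin n) (w : Word n) :
    leftCreation i (basisVec w) = basisVec (FreeMonoid.of i * w) := by
  simp [leftCreation, basisVec]

/-- The operator `L_i ⊗ I`. -/
noncomputable def creation (i : Fin n) : FockTensor n E' →L[ℂ] FockTensor n E' :=
  tensorMap (leftCreation i) LinearIsometry.id

theorem creation_single (i : Fin n) (w : Word n) (h : E') :
    creation i (lp.single 2 w h) = lp.single 2 (FreeMonoid.of i * w) h := by
  rw [creation, tensorMap_single, leftCreation_basisVec, tmul_basisVec]; rfl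

theorem creation_apply_one (i : Fin n) (u : FockTensor n E') : creation i u 1 = 0 := by
  have : lp.evalCLM ℂ (fun _ : Word n => E') 2 1 ∘L creation i = 0 := by
    refine clm_ext fun w x => ?_
    simp only [ContinuousLinearMap.comp_apply, creation_single]
    change (lp.single 2 (FreeMonoid.of i * w) x : FockTensor n E') 1 = 0
    rw [lp.single_apply_ne]
    intro h
    exact List.cons_ne_nil _ _ h.symm
  exact congrArg (fun A => A u) this

theorem creation_apply_cons (i j : Fin n) (w : Word n) (u : FockTensor n E') :
    creation i u (FreeMonoid.of j * w) = if j = i then u w else 0 := by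
  have : lp.evalCLM ℂ (fun _ : Word n => E') 2 (FreeMonoid.of j * w) ∘L creation i =
      if j = i then lp.evalCLM ℂ (fun _ : Word n => E') 2 w else 0 := by
    refine clm_ext fun v x => ?_
    simp only [ContinuousLinearMap.comp_apply, creation_single]
    change (lp.single 2 (FreeMonoid.of i * v) x : FockTensor n E') (FreeMonoid.of j * w) = _
    have key : (FreeMonoid.of j * w = FreeMonoid.of i * v) ↔ (j = i ∧ w = v) := by
      constructor
      · intro h
        have := List.cons_eq_cons.1 h
        exact this
      · rintro ⟨rfl, rfl⟩; rfl
    by_cases hj : j = i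
    · rw [if_pos hj]
      change _ = (lp.single 2 v x : FockTensor n E') w
      by_cases hw : w = v
      · subst hj; subst hw; simp
      · rw [lp.single_apply_ne _ _ _ hw, lp.single_apply_ne]
        intro h; exact hw (key.1 h).2
    · rw [if_neg hj, lp.single_apply_ne]; rfl
      intro h; exact hj (key.1 h).1
  have h2 := congrArg (fun A => A u) this
  by_cases hj : j = i
  · simp only [if_pos hj] at h2 ⊢; exact h2
  · simp only [if_neg hj] at h2 ⊢; exact h2

end Fock


section Defect

variable {E F : Type*} [NormedAddCommGroup E] [InnerProductSpace ℂ E] [CompleteSpace E]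
  [NormedAddCommGroup F] [InnerProductSpace ℂ F] [CompleteSpace F]

/-- The defect operator `D_C = (1 - C* C)^{1/2}` (meaningful for contractions `C`). -/
noncomputable def defectOp (C : E →L[ℂ] F) : E →L[ℂ] E := CFC.sqrt (1 - adjoint C ∘L C)

/-- The defect space of `C`, the closure of the range of `D_C`. -/
noncomputable def defectSpace (C : E →L[ℂ] F) : Submodule ℂ E :=
  (LinearMap.range (defectOp C).toLinearMap).topologicalClosure

instance (C : E →L[ℂ] F) : CompleteSpace (defectSpace C) :=
  (Submodule.isClosed_topologicalClosure _).completeSpace_coe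

theorem defectOp_mem (C : E →L[ℂ] F) (x : E) : defectOp C x ∈ defectSpace C :=
  Submodule.le_topologicalClosure _ ⟨x, rfl⟩

theorem defectOp_nonneg (C : E →L[ℂ] F) : 0 ≤ defectOp C := CFC.sqrt_nonneg _

theorem defectOp_symm (C : E →L[ℂ] F) (x y : E) : ⟪defectOp C x, y⟫_ℂ = ⟪x, defectOp C y⟫_ℂ :=
  ((ContinuousLinearMap.nonneg_iff_isPositive _).1 (defectOp_nonneg C)).isSymmetric x y

theorem one_sub_nonneg {C : E →L[ℂ] F} (hC : ∀ x, ‖C x‖ ≤ ‖x‖) : 0 ≤ 1 - adjoint C ∘L C := by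
  rw [ContinuousLinearMap.nonneg_iff_isPositive, ContinuousLinearMap.isPositive_iff_complex]
  intro x
  have : ⟪(1 - adjoint C ∘L C) x, x⟫_ℂ = ((‖x‖ ^ 2 - ‖C x‖ ^ 2 : ℝ) : ℂ) := by
    simp [inner_sub_left, ContinuousLinearMap.adjoint_inner_left]
  rw [this]
  have := hC x
  refine ⟨by simp only [RCLike.re_to_complex, Complex.ofReal_re], ?_⟩
  have h0 := norm_nonneg (C x)
  simp only [RCLike.re_to_complex, Complex.ofReal_re]
  nlinarith

theorem defectOp_mul_self {C : E →L[ℂ] F} (hC : ∀ x, ‖C x‖ ≤ ‖x‖) :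
    defectOp C * defectOp C = 1 - adjoint C ∘L C :=
  CFC.sqrt_mul_sqrt_self _ (one_sub_nonneg hC)

theorem defectOp_apply_apply {C : E →L[ℂ] F} (hC : ∀ x, ‖C x‖ ≤ ‖x‖) (x : E) :
    defectOp C (defectOp C x) = x - adjoint C (C x) := by
  have := congrArg (fun A => A x) (defectOp_mul_self hC)
  simpa using this

theorem norm_defectOp_sq {C : E →L[ℂ] F} (hC : ∀ x, ‖C x‖ ≤ ‖x‖) (x : E) :
    ‖defectOp C x‖ ^ 2 = ‖x‖ ^ 2 - ‖C x‖ ^ 2 := by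
  have h : ⟪defectOp C x, defectOp C x⟫_ℂ = ((‖x‖ ^ 2 - ‖C x‖ ^ 2 : ℝ) : ℂ) := by
    rw [defectOp_symm, defectOp_apply_apply hC]
    simp [inner_sub_right, ContinuousLinearMap.adjoint_inner_right]
  have h2 := congrArg Complex.re h
  rw [Complex.ofReal_re] at h2
  rw [← h2]
  exact (inner_self_eq_norm_sq (𝕜 := ℂ) _).symm

theorem norm_adjoint_le {C : E →L[ℂ] F} (hC : ∀ x, ‖C x‖ ≤ ‖x‖) (y : F) :
    ‖adjoint C y‖ ≤ ‖y‖ := by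
  have h1 : ‖C‖ ≤ 1 := C.opNorm_le_bound zero_le_one (by simpa using hC)
  have h2 : ‖adjoint C‖ ≤ 1 := by rwa [LinearIsometryEquiv.norm_map]
  calc _ ≤ ‖adjoint C‖ * ‖y‖ := (adjoint C).le_opNorm y
    _ ≤ 1 * ‖y‖ := by gcongr
    _ = _ := one_mul _

/-- If `A`, `B` are nonnegative operators and `C A² = B² C`, then `C A = B C`. -/
theorem intertwine_of_sq {A : E →L[ℂ] E} {B : F →L[ℂ] F} (hA : 0 ≤ A) (hB : 0 ≤ B)
    (C : E →L[ℂ] F) (h : ∀ x, C (A (A x)) = B (B (C x))) (x : E) : C (A x) = B (C x) := by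
  have hAp := (ContinuousLinearMap.nonneg_iff_isPositive _).1 hA
  have hBp := (ContinuousLinearMap.nonneg_iff_isPositive _).1 hB
  set S : E →L[ℂ] F := C ∘L A - B ∘L C with hS
  have hBS : ∀ x, B (S x) = - S (A x) := fun x => by simp [hS, h]
  have hPnn : 0 ≤ adjoint S ∘L S := by
    rw [ContinuousLinearMap.nonneg_iff_isPositive]
    exact ContinuousLinearMap.isPositive_adjoint_comp_self S
  have hPBS : (adjoint S ∘L B ∘L S) = - ((adjoint S ∘L S) * A) := by
    ext x; simp [hBS]
  have hnn2 : 0 ≤ adjoint S ∘L B ∘L S := by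
    rw [ContinuousLinearMap.nonneg_iff_isPositive]
    exact hBp.adjoint_conj S
  have hcomm : Commute (adjoint S ∘L S) A := by
    have h1 : IsSelfAdjoint (adjoint S ∘L B ∘L S) := IsSelfAdjoint.of_nonneg hnn2
    rw [hPBS] at h1
    have h2 : IsSelfAdjoint ((adjoint S ∘L S) * A) := by simpa using h1.neg
    have h3 := h2.star_eq
    rw [star_mul, (IsSelfAdjoint.of_nonneg hA).star_eq, (IsSelfAdjoint.of_nonneg hPnn).star_eq] at h3
    exact h3.symm
  have hprod := Commute.mul_nonneg hPnn hA hcomm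
  have hzero : (adjoint S ∘L S) * A = 0 := by
    refine le_antisymm ?_ hprod
    rw [hPBS] at hnn2
    exact neg_nonneg.1 hnn2
  have hSA : ∀ x, S (A x) = 0 := fun x => by
    have h1 : adjoint S (S (A x)) = 0 := by simpa using congrArg (fun D => D x) hzero
    have h2 : ⟪S (A x), S (A x)⟫_ℂ = 0 := by
      rw [← ContinuousLinearMap.adjoint_inner_left, h1, inner_zero_left]
    exact inner_self_eq_zero.1 h2
  have hker : ∀ v, A v = 0 → S v = 0 := fun v hv => by
    have h1 : S v = - B (C v) := by simp [hS, hv]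
    have h2 : B (B (C v)) = 0 := by rw [← h, hv]; simp
    have h3 : ⟪B (C v), B (C v)⟫_ℂ = 0 := by
      have := hBp.isSymmetric (B (C v)) (C v)
      simp only [ContinuousLinearMap.coe_coe] at this
      rw [← this, h2, inner_zero_left]
    rw [h1, inner_self_eq_zero.1 h3, neg_zero]
  have hAS : ∀ y, A (adjoint S y) = 0 := fun y => by
    refine ext_inner_right ℂ fun x => ?_
    have := hAp.isSymmetric (adjoint S y) x
    simp only [ContinuousLinearMap.coe_coe] at this
    rw [this, ContinuousLinearMap.adjoint_inner_left, hSA, inner_zero_right, inner_zero_left]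
  have hadj : ∀ y, adjoint S y = 0 := fun y => by
    have h1 := hker _ (hAS y)
    have h2 : ⟪adjoint S y, adjoint S y⟫_ℂ = 0 := by
      rw [ContinuousLinearMap.adjoint_inner_left, h1, inner_zero_right]
    exact inner_self_eq_zero.1 h2
  have hSx : S x = 0 := by
    have h2 : ⟪S x, S x⟫_ℂ = 0 := by
      rw [← ContinuousLinearMap.adjoint_inner_left, hadj, inner_zero_left]
    exact inner_self_eq_zero.1 h2
  exact sub_eq_zero.1 hSx

theorem defect_intertwine {C : E →L[ℂ] F} (hC : ∀ x, ‖C x‖ ≤ ‖x‖) (x : E) :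
    C (defectOp C x) = defectOp (adjoint C) (C x) := by
  refine intertwine_of_sq (defectOp_nonneg C) (defectOp_nonneg _) C (fun x => ?_) x
  rw [defectOp_apply_apply hC, defectOp_apply_apply (norm_adjoint_le hC)]
  simp

/-- A contraction maps its defect space into that of its adjoint. -/
theorem map_defectSpace {C : E →L[ℂ] F} (hC : ∀ x, ‖C x‖ ≤ ‖x‖) {x : E}
    (hx : x ∈ defectSpace C) : C x ∈ defectSpace (adjoint C) := by
  have h : defectSpace C ≤ (defectSpace (adjoint C)).comap C.toLinearMap := by
    refine Submodule.topologicalClosure_minimal _ ?_ ?_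
    · rintro _ ⟨y, rfl⟩
      change C (defectOp C y) ∈ defectSpace (adjoint C)
      rw [defect_intertwine hC]
      exact defectOp_mem _ _
    · exact (Submodule.isClosed_topologicalClosure _).preimage C.continuous
  exact h hx

end Defect

section Row

variable {n : ℕ} {H : Type*} [NormedAddCommGroup H] [InnerProductSpace ℂ H] [CompleteSpace H]

/-- The row operator `(T_1 ⋯ T_n) : H^n → H`. -/
noncomputable def rowOp (T : Fin n → H →L[ℂ] H) : PiLp 2 (fun _ : Fin n => H) →L[ℂ] H :=
  ∑ i, T i ∘L PiLp.proj 2 (fun _ : Fin n => H) i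

theorem rowOp_apply (T : Fin n → H →L[ℂ] H) (u : PiLp 2 (fun _ : Fin n => H)) :
    rowOp T u = ∑ i, T i (u i) := by
  simp [rowOp]

theorem adjoint_rowOp_apply (T : Fin n → H →L[ℂ] H) (h : H) (i : Fin n) :
    adjoint (rowOp T) h i = adjoint (T i) h := by
  have : adjoint (rowOp T) h = WithLp.toLp 2 (fun i => adjoint (T i) h) := by
    refine ext_inner_right ℂ fun u => ?_
    rw [ContinuousLinearMap.adjoint_inner_left, rowOp_apply, PiLp.inner_apply, inner_sum]
    simp [ContinuousLinearMap.adjoint_inner_left]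
  rw [this]

variable (n H) in
/-- A row contraction (multicontraction): `n` operators on `H`, not assumed to commute, with
`∑ T_i T_i* ≤ 1`; by `sum_le_one_iff` this says that the row operator from `H^n` to `H` is a
contraction. -/
structure RowContraction where
  op : Fin n → H →L[ℂ] H
  sum_le : ∑ i, op i ∘L adjoint (op i) ≤ 1

theorem sum_le_one_iff (T : Fin n → H →L[ℂ] H) :
    ∑ i, T i ∘L adjoint (T i) ≤ 1 ↔ ∀ u, ‖rowOp T u‖ ≤ ‖u‖ := by
  have key : ∀ h, ⟪((1 : H →L[ℂ] H) - ∑ i, T i ∘L adjoint (T i)) h, h⟫_ℂ =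
      ((‖h‖ ^ 2 - ‖adjoint (rowOp T) h‖ ^ 2 : ℝ) : ℂ) := fun h => by
    rw [PiLp.norm_sq_eq_of_L2]
    simp only [adjoint_rowOp_apply, sub_apply, inner_sub_left, one_apply_eq_self, sum_apply,
      sum_inner, ContinuousLinearMap.comp_apply]
    simp [← ContinuousLinearMap.adjoint_inner_right]
  rw [← sub_nonneg, ContinuousLinearMap.nonneg_iff_isPositive,
    ContinuousLinearMap.isPositive_iff_complex]
  simp only [key]
  constructor
  · intro h
    have h1 : ∀ y, ‖adjoint (rowOp T) y‖ ≤ ‖y‖ := fun y => by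
      have := (h y).2
      simp only [RCLike.re_to_complex, Complex.ofReal_re] at this
      exact (sq_le_sq₀ (norm_nonneg _) (norm_nonneg _)).1 (by linarith)
    have := norm_adjoint_le h1
    simpa using this
  · intro h y
    refine ⟨by simp only [RCLike.re_to_complex, Complex.ofReal_re], ?_⟩
    have := (sq_le_sq₀ (norm_nonneg _) (norm_nonneg _)).2 (norm_adjoint_le h y)
    simp only [RCLike.re_to_complex, Complex.ofReal_re]
    linarith

namespace RowContraction

variable (T : RowContraction n H)

/-- The row contraction `T`, as an operator from `H^n` (with its Hilbert space norm) to `H`. -/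
noncomputable def row : PiLp 2 (fun _ : Fin n => H) →L[ℂ] H := rowOp T.op

theorem norm_row_le (u : PiLp 2 (fun _ : Fin n => H)) : ‖T.row u‖ ≤ ‖u‖ :=
  (sum_le_one_iff T.op).1 T.sum_le u

/-- The defect operator `D_T = (1 - T* T)^{1/2}` on `H^n`. -/
noncomputable abbrev D := defectOp T.row
/-- The defect operator `D_{T*} = (1 - T T*)^{1/2}` on `H`. -/
noncomputable abbrev Dstar := defectOp (adjoint T.row)
/-- The defect space of `T`, the closure of the range of `D_T`. -/
noncomputable abbrev defect : Submodule ℂ (PiLp 2 (fun _ : Fin n => H)) := defectSpace T.row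
/-- The defect space of `T*`, the closure of the range of `D_{T*}`. -/
noncomputable abbrev defectStar : Submodule ℂ H := defectSpace (adjoint T.row)

end RowContraction
end Row

section Characteristic

variable {n : ℕ}

section Sums
variable {E : Type*} [NormedAddCommGroup E]

theorem memℓp_two {f : Word n → E} {C : ℝ} (h : ∀ s : Finset (Word n), ∑ w ∈ s, ‖f w‖ ^ 2 ≤ C) :
    Memℓp f 2 :=
  memℓp_gen' (C := C) fun s => by simpa using h s

theorem sum_sq_le (u : FockTensor n E) (s : Finset (Word n)) : ∑ w ∈ s, ‖u w‖ ^ 2 ≤ ‖u‖ ^ 2 := by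
  simpa using lp.sum_rpow_le_norm_rpow (p := 2) (by simp) u s

theorem norm_le_of_sum_sq {u : FockTensor n E} {C : ℝ} (hC : 0 ≤ C)
    (h : ∀ s : Finset (Word n), ∑ w ∈ s, ‖u w‖ ^ 2 ≤ C ^ 2) : ‖u‖ ≤ C :=
  lp.norm_le_of_forall_sum_le (p := 2) (by simp) hC fun s => by simpa using h s

/-- The finite set of lists of length `k`. -/
def level (n : ℕ) : ℕ → Finset (List (Fin n))
  | 0 => {[]}
  | k + 1 => ((Finset.univ : Finset (Fin n)) ×ˢ level n k).image fun p => p.1 :: p.2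

theorem mem_level {k : ℕ} {l : List (Fin n)} : l ∈ level n k ↔ l.length = k := by
  induction k generalizing l with
  | zero => simp [level]
  | succ k ih =>
    cases l with
    | nil => simp [level]
    | cons i l => simp [level, ih]

theorem sum_level_succ (f : List (Fin n) → ℝ) (k : ℕ) :
    ∑ l ∈ level n (k + 1), f l = ∑ l ∈ level n k, ∑ i, f (i :: l) := by
  rw [level, Finset.sum_image, Finset.sum_product_right]
  rintro ⟨i, l⟩ - ⟨j, l'⟩ - h
  simpa using h

theorem level_disjoint : Set.PairwiseDisjoint Set.univ (level n) := by
  intro j _ k _ hjk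
  refine Finset.disjoint_left.2 fun l hl hl' => hjk ?_
  rw [mem_level] at hl hl'
  omega

/-- Energy estimate for a system whose states satisfy a balance equation. -/
theorem sum_le_of_balance {x y u : List (Fin n) → ℝ} (hx : ∀ l, 0 ≤ x l) (hy : ∀ l, 0 ≤ y l)
    (h : ∀ l, y l + ∑ i, x (i :: l) = x l + u l) {C : ℝ}
    (hC : ∀ s : Finset (List (Fin n)), ∑ l ∈ s, u l ≤ C) (s : Finset (List (Fin n))) :
    ∑ l ∈ s, y l ≤ x [] + C := by
  have key : ∀ N, ∑ k ∈ Finset.range N, ∑ l ∈ level n k, y l + ∑ l ∈ level n N, x l =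
      x [] + ∑ k ∈ Finset.range N, ∑ l ∈ level n k, u l := by
    intro N
    induction N with
    | zero => simp [level]
    | succ N ih =>
      rw [Finset.sum_range_succ, Finset.sum_range_succ, sum_level_succ, ← add_assoc, ← ih,
        add_assoc, ← Finset.sum_add_distrib, Finset.sum_congr rfl (fun l _ => h l),
        Finset.sum_add_distrib]
      ring
  set N := s.sup List.length + 1
  have hs : s ⊆ (Finset.range N).biUnion (level n) := fun l hl => by
    rw [Finset.mem_biUnion]
    exact ⟨l.length, Finset.mem_range.2 (Nat.lt_succ_of_le (Finset.le_sup (f := List.length) hl)),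
      mem_level.2 rfl⟩
  have hd : ((Finset.range N : Finset ℕ) : Set ℕ).PairwiseDisjoint (level n) :=
    level_disjoint.subset (Set.subset_univ _)
  calc ∑ l ∈ s, y l ≤ ∑ l ∈ (Finset.range N).biUnion (level n), y l :=
        Finset.sum_le_sum_of_subset_of_nonneg hs fun l _ _ => hy l
    _ = ∑ k ∈ Finset.range N, ∑ l ∈ level n k, y l := Finset.sum_biUnion hd
    _ ≤ x [] + ∑ k ∈ Finset.range N, ∑ l ∈ level n k, u l := by
        rw [← key N]
        have := Finset.sum_nonneg (s := level n N) (f := x) fun l _ => hx l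
        linarith
    _ = x [] + ∑ l ∈ (Finset.range N).biUnion (level n), u l := by rw [Finset.sum_biUnion hd]
    _ ≤ _ := by gcongr; exact hC _

end Sums

variable {H : Type*} [NormedAddCommGroup H] [InnerProductSpace ℂ H] [CompleteSpace H]

namespace RowContraction

variable (T : RowContraction n H)

theorem halmos (x : H) (v : PiLp 2 (fun _ : Fin n => H)) :
    ‖T.Dstar x - T.row v‖ ^ 2 + ‖adjoint T.row x + T.D v‖ ^ 2 = ‖x‖ ^ 2 + ‖v‖ ^ 2 := by
  rw [@norm_sub_sq ℂ, @norm_add_sq ℂ, norm_defectOp_sq T.norm_row_le,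
    norm_defectOp_sq (norm_adjoint_le T.norm_row_le)]
  have : ⟪T.Dstar x, T.row v⟫_ℂ = ⟪adjoint T.row x, T.D v⟫_ℂ := by
    rw [defectOp_symm, ← defect_intertwine T.norm_row_le, ContinuousLinearMap.adjoint_inner_left]
  rw [this]
  ring

/-- Auxiliary recursion: the states of the linear system with initial state `h` and input `u`, listed
along the reverses of the words. -/
noncomputable def state (h : H) (u : Word n → T.defect) : List (Fin n) → H
  | [] => h
  | i :: l => (adjoint T.row (state h u l) + T.D (u (FreeMonoid.ofList l.reverse))) i

/-- Auxiliary: the outputs of the linear system with initial state `h` and input `u`. -/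
noncomputable def output (h : H) (u : Word n → T.defect) (w : Word n) : H :=
  T.Dstar (T.state h u w.toList.reverse) - T.row (u w)

theorem output_mem (h : H) (u : Word n → T.defect) (w : Word n) :
    T.output h u w ∈ T.defectStar :=
  T.defectStar.sub_mem (defectOp_mem _ _) (map_defectSpace T.norm_row_le (u w).2)

theorem sum_output_le (h : H) (u : Word n → T.defect) {C : ℝ}
    (hC : ∀ s : Finset (Word n), ∑ w ∈ s, ‖u w‖ ^ 2 ≤ C) (s : Finset (Word n)) :
    ∑ w ∈ s, ‖T.output h u w‖ ^ 2 ≤ ‖h‖ ^ 2 + C := by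
  let r : List (Fin n) ≃ Word n :=
    ⟨fun l => FreeMonoid.ofList l.reverse, fun w => w.toList.reverse,
      fun l => by simp, fun w => by simp⟩
  have := sum_le_of_balance (n := n) (x := fun l => ‖T.state h u l‖ ^ 2)
    (y := fun l => ‖T.output h u (r l)‖ ^ 2) (u := fun l => ‖u (r l)‖ ^ 2) (C := C)
    (fun l => by positivity) (fun l => by positivity)
    (fun l => ?_) (fun s => ?_) (s.map r.symm.toEmbedding)
  · simpa [state] using this
  · have := T.halmos (T.state h u l) (u (r l))
    rw [PiLp.norm_sq_eq_of_L2 _ (adjoint T.row _ + _)] at this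
    simpa [output, r, state] using this
  · simpa using hC (s.map r.toEmbedding)

theorem state_add (h h' : H) (u u' : Word n → T.defect) (l : List (Fin n)) :
    T.state (h + h') (u + u') l = T.state h u l + T.state h' u' l := by
  induction l with
  | nil => rfl
  | cons i l ih => simp only [state, ih, map_add, Pi.add_apply, Submodule.coe_add, PiLp.add_apply]; abel

theorem state_smul (c : ℂ) (h : H) (u : Word n → T.defect) (l : List (Fin n)) :
    T.state (c • h) (c • u) l = c • T.state h u l := by
  induction l with
  | nil => rfl
  | cons i l ih => simp [state, ih]

theorem state_zero_right (h : H) (l : List (Fin n)) :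
    T.state h 0 l = adjoint (FreeMonoid.lift T.op (FreeMonoid.ofList l.reverse)) h := by
  induction l with
  | nil =>
    have : FreeMonoid.lift T.op (FreeMonoid.ofList ([] : List (Fin n)).reverse) = 1 := map_one _
    rw [this, ← ContinuousLinearMap.star_eq_adjoint, star_one]
    rfl
  | cons i l ih =>
    have : FreeMonoid.ofList (i :: l).reverse = FreeMonoid.ofList l.reverse * FreeMonoid.of i := by
      simp [FreeMonoid.ofList_append]
    rw [this, map_mul, FreeMonoid.lift_eval_of]
    simp only [state, ih, row, Pi.zero_apply, ZeroMemClass.coe_zero, map_zero, add_zero,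
      adjoint_rowOp_apply]
    rw [ContinuousLinearMap.mul_def, ContinuousLinearMap.adjoint_comp]
    rfl

/-- The operator `T_w = T_{i_1} ⋯ T_{i_k}`, for a word `w = i_1 ⋯ i_k`. -/
noncomputable def word (w : Word n) : H →L[ℂ] H := FreeMonoid.lift T.op w

theorem output_zero_right (h : H) (w : Word n) :
    T.output h 0 w = T.Dstar (adjoint (T.word w) h) := by
  simp [output, state_zero_right, word]

/-- The coordinates of `K_T h`. -/
noncomputable def poissonCoord (h : H) (w : Word n) : T.defectStar :=
  ⟨T.Dstar (adjoint (T.word w) h), defectOp_mem _ _⟩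

theorem sum_poissonCoord_le (h : H) (s : Finset (Word n)) :
    ∑ w ∈ s, ‖T.poissonCoord h w‖ ^ 2 ≤ ‖h‖ ^ 2 := by
  have := T.sum_output_le h 0 (C := 0) (by simp) s
  simpa [poissonCoord, output_zero_right] using this

theorem poisson_add (h k : H) (w : Word n) : T.Dstar (adjoint (T.word w) (h + k)) =
    T.Dstar (adjoint (T.word w) h) + T.Dstar (adjoint (T.word w) k) := by
  rw [map_add, map_add]

theorem poisson_smul (c : ℂ) (h : H) (w : Word n) : T.Dstar (adjoint (T.word w) (c • h)) =
    c • T.Dstar (adjoint (T.word w) h) := by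
  rw [map_smul, map_smul]

/-- The Poisson kernel `K_T h = ∑_w e_w ⊗ D_{T*} (T_w)* h`, see `poissonKernel_apply`. -/
noncomputable def poissonKernel : H →L[ℂ] FockTensor n T.defectStar :=
  LinearMap.mkContinuous
    { toFun := fun h => ⟨T.poissonCoord h, memℓp_two (T.sum_poissonCoord_le h)⟩
      map_add' := fun h k => by
        refine lp.ext (funext fun w => Subtype.ext ?_)
        exact T.poisson_add h k w
      map_smul' := fun c h => by
        refine lp.ext (funext fun w => Subtype.ext ?_)
        exact T.poisson_smul c h w }
    1 (fun h => by
      rw [one_mul]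
      exact norm_le_of_sum_sq (norm_nonneg _) (T.sum_poissonCoord_le h))

theorem poissonKernel_apply (h : H) (w : Word n) :
    (T.poissonKernel h w : H) = T.Dstar (adjoint (T.word w) h) := rfl

end RowContraction

/-- An operator `M` is multianalytic if `M (L_i ⊗ I) = (L_i ⊗ I) M` for all `i`. -/
def IsMultianalytic {E E' : Type*} [NormedAddCommGroup E] [InnerProductSpace ℂ E] [CompleteSpace E]
    [NormedAddCommGroup E'] [InnerProductSpace ℂ E'] [CompleteSpace E']
    (M : FockTensor n E →L[ℂ] FockTensor n E') : Prop :=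
  ∀ i, M ∘L creation i = creation i ∘L M

/-- The coefficients `m_w` of the formal Fourier expansion `∑_w R_w ⊗ m_w` of a multianalytic operator:
`m_w k` is the component of `M (1 ⊗ k)` along `e_v`, where `v` is the reverse of `w`. (The right
creation operators satisfy `R_w 1 = e_v`.) -/
noncomputable def fourierCoeff {E E' : Type*} [NormedAddCommGroup E] [InnerProductSpace ℂ E]
    [NormedAddCommGroup E'] [InnerProductSpace ℂ E']
    (M : FockTensor n E →L[ℂ] FockTensor n E') (w : Word n) (k : E) : E' :=
  M (tmul (basisVec 1) k) w.reverse

namespace RowContraction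
variable (T : RowContraction n H)

/-- `M` is the multianalytic operator with the formal Fourier expansion
`-I ⊗ T + (I ⊗ D_{T*}) (1 - ∑ R_i ⊗ T_i*)⁻¹ [R_1 ⊗ I, …, R_n ⊗ I] (I ⊗ D_T)`.
Expanding the inverse into a geometric series gives the coefficients: `-T` at the empty word, and
`D_{T*} T_{i_1}* ⋯ T_{i_k}* P_j D_T` at the word `i_1 ⋯ i_k j`, where `P_j` is the projection of `H^n`
onto its `j`-th component. All of them are restricted to the defect space of `T`. -/
structure IsCharacteristicFunction (M : FockTensor n T.defect →L[ℂ] FockTensor n T.defectStar) :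
    Prop where
  multianalytic : IsMultianalytic M
  coeff_one : ∀ k : T.defect, ((fourierCoeff M 1 k : T.defectStar) : H) = - T.row k
  coeff_mul_of : ∀ (v : Word n) (j : Fin n) (k : T.defect),
    ((fourierCoeff M (v * FreeMonoid.of j) k : T.defectStar) : H) =
      T.Dstar (FreeMonoid.lift (fun i => adjoint (T.op i)) v (T.D k j))

theorem output_add (u v : Word n → T.defect) (w : Word n) :
    T.output 0 (u + v) w = T.output 0 u w + T.output 0 v w := by
  have := T.state_add 0 0 u v w.toList.reverse
  rw [add_zero] at this
  rw [output, output, output, this, Pi.add_apply, Submodule.coe_add, map_add, map_add]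
  abel

theorem output_smul (c : ℂ) (u : Word n → T.defect) (w : Word n) :
    T.output 0 (c • u) w = c • T.output 0 u w := by
  have := T.state_smul c 0 u w.toList.reverse
  rw [smul_zero] at this
  rw [output, output, this, Pi.smul_apply, Submodule.coe_smul, map_smul, map_smul, smul_sub]

theorem sum_charCoord_le (u : FockTensor n T.defect) (s : Finset (Word n)) :
    ∑ w ∈ s, ‖(⟨T.output 0 u w, T.output_mem 0 u w⟩ : T.defectStar)‖ ^ 2 ≤ ‖u‖ ^ 2 := by
  have := T.sum_output_le 0 u (sum_sq_le u) s
  rw [norm_zero, zero_pow two_ne_zero, zero_add] at this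
  exact this

/-- Auxiliary: the operator that is shown below to be the characteristic function. -/
noncomputable def charMap : FockTensor n T.defect →L[ℂ] FockTensor n T.defectStar :=
  LinearMap.mkContinuous
    { toFun := fun u => ⟨fun w => ⟨T.output 0 u w, T.output_mem 0 u w⟩,
        memℓp_two (T.sum_charCoord_le u)⟩
      map_add' := fun u v => by
        refine lp.ext (funext fun w => Subtype.ext ?_)
        exact T.output_add u v w
      map_smul' := fun c u => by
        refine lp.ext (funext fun w => Subtype.ext ?_)
        exact T.output_smul c u w }
    1 (fun u => by
      rw [one_mul]
      exact norm_le_of_sum_sq (norm_nonneg _) (T.sum_charCoord_le u))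

theorem charMap_apply (u : FockTensor n T.defect) (w : Word n) :
    (T.charMap u w : H) = T.output 0 u w := rfl

theorem state_creation (i : Fin n) (u : FockTensor n T.defect) (j : Fin n) (l : List (Fin n)) :
    T.state 0 (creation i u) (l ++ [j]) = if j = i then T.state 0 u l else 0 := by
  induction l with
  | nil =>
    have : creation i u (FreeMonoid.ofList ([] : List (Fin n)).reverse) = 0 :=
      creation_apply_one i u
    simp only [List.nil_append, state]
    rw [this]
    simp
  | cons a l ih =>
    have : creation i u (FreeMonoid.ofList (l ++ [j]).reverse) =
        if j = i then u (FreeMonoid.ofList l.reverse) else 0 := by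
      rw [← creation_apply_cons]; simp
    rw [List.cons_append, state, ih, this]
    split_ifs
    · rfl
    · simp

theorem state_single (k : T.defect) (v : Word n) (j : Fin n) :
    T.state 0 (lp.single 2 (1 : Word n) k : FockTensor n T.defect) (v.toList ++ [j]) =
      FreeMonoid.lift (fun i => adjoint (T.op i)) v (T.D k j) := by
  induction v using FreeMonoid.inductionOn' with
  | one =>
    have : (lp.single 2 (1 : Word n) k : FockTensor n T.defect)
        (FreeMonoid.ofList ([] : List (Fin n)).reverse) = k :=
      lp.single_apply_self _ _ _
    simp only [FreeMonoid.toList_one, List.nil_append, state]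
    rw [this]
    simp
  | of_mul a v ih =>
    have h0 : (lp.single 2 (1 : Word n) k : FockTensor n T.defect)
        (FreeMonoid.ofList (v.toList ++ [j]).reverse) = 0 := by
      refine lp.single_apply_ne _ _ _ fun h => ?_
      have : (v.toList ++ [j]).reverse = [] := h
      simp at this
    rw [FreeMonoid.toList_of_mul, List.cons_append, state, ih, h0, map_mul,
      FreeMonoid.lift_eval_of]
    simp [row, adjoint_rowOp_apply]

theorem isCharacteristicFunction_charMap : T.IsCharacteristicFunction T.charMap where
  multianalytic i := by
    ext u : 1
    refine lp.ext (funext fun w => Subtype.ext ?_)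
    simp only [ContinuousLinearMap.comp_apply]
    cases w using FreeMonoid.casesOn with
    | one =>
      rw [creation_apply_one, charMap_apply, output, creation_apply_one]
      simp [state]
    | of_mul j w =>
      rw [creation_apply_cons, charMap_apply, output, creation_apply_cons, FreeMonoid.toList_of_mul,
        List.reverse_cons, state_creation]
      split_ifs
      · rfl
      · simp
  coeff_one k := by
    rw [fourierCoeff, charMap_apply, tmul_basisVec, output]
    have : FreeMonoid.reverse (1 : Word n) = 1 := rfl
    rw [this, lp.single_apply_self]
    simp [state]
  coeff_mul_of v j k := by
    rw [fourierCoeff, charMap_apply, tmul_basisVec, output]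
    have h1 : (FreeMonoid.reverse (v * FreeMonoid.of j)).toList.reverse = v.toList ++ [j] :=
      List.reverse_reverse (v.toList ++ [j])
    have h2 : (lp.single 2 (1 : Word n) k : FockTensor n T.defect)
        (FreeMonoid.reverse (v * FreeMonoid.of j)) = 0 := by
      refine lp.single_apply_ne _ _ _ fun h => ?_
      have h3 : (v.toList ++ [j]).reverse = [] := h
      simp at h3
    rw [h1, h2, state_single]
    simp

theorem existsUnique_characteristicFunction :
    ∃! M : FockTensor n T.defect →L[ℂ] FockTensor n T.defectStar, T.IsCharacteristicFunction M := by
  refine ⟨T.charMap, T.isCharacteristicFunction_charMap, fun M hM => ?_⟩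
  have hN := T.isCharacteristicFunction_charMap
  refine clm_ext fun w x => ?_
  induction w using FreeMonoid.inductionOn' with
  | one =>
    refine lp.ext (funext fun w => Subtype.ext ?_)
    rw [← tmul_basisVec]
    obtain ⟨v, rfl⟩ : ∃ v : Word n, v.reverse = w := ⟨w.reverse, FreeMonoid.reverse_reverse⟩
    change ((fourierCoeff M v x : T.defectStar) : H) = (fourierCoeff T.charMap v x : T.defectStar)
    rcases List.eq_nil_or_concat v.toList with h | ⟨l, j, h⟩
    · have : v = 1 := h
      rw [this, hM.coeff_one, hN.coeff_one]
    · rw [List.concat_eq_append] at h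
      have : v = FreeMonoid.ofList l * FreeMonoid.of j := h
      rw [this, hM.coeff_mul_of, hN.coeff_mul_of]
  | of_mul i w ih =>
    rw [← creation_single]
    have h1 := congrArg (fun A => A (lp.single 2 w x)) (hM.multianalytic i)
    have h2 := congrArg (fun A => A (lp.single 2 w x)) (hN.multianalytic i)
    simp only [ContinuousLinearMap.comp_apply] at h1 h2
    rw [h1, h2, ih]

/-- The characteristic function `Θ_T`. -/
noncomputable def characteristicFunction : FockTensor n T.defect →L[ℂ] FockTensor n T.defectStar :=
  T.existsUnique_characteristicFunction.choose

end RowContraction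

end Characteristic

section Calculus

variable {n : ℕ}

/-- The left creation operator `L_i` on the Fock space. -/
noncomputable def L (i : Fin n) : Fock n →L[ℂ] Fock n := (leftCreation i).toContinuousLinearMap

theorem L_basisVec (i : Fin n) (w : Word n) :
    L i (basisVec w) = basisVec (FreeMonoid.of i * w) := leftCreation_basisVec i w

variable (n) in
/-- The norm closed unital algebra `𝔩_n` generated by `L_1, …, L_n`. -/
noncomputable def normAlg : Subalgebra ℂ (Fock n →L[ℂ] Fock n) :=
  (Algebra.adjoin ℂ (Set.range L)).topologicalClosure

theorem L_mem_normAlg (i : Fin n) : L i ∈ normAlg n :=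
  Subalgebra.le_topologicalClosure _ (Algebra.subset_adjoin ⟨i, rfl⟩)

section MatOp
variable {m : ℕ} {E : Type*} [NormedAddCommGroup E] [InnerProductSpace ℂ E]

/-- The operator on `E^m` (with its Hilbert space norm) given by a matrix of operators on `E`. -/
noncomputable def matOp (A : Matrix (Fin m) (Fin m) (E →L[ℂ] E)) :
    PiLp 2 (fun _ : Fin m => E) →L[ℂ] PiLp 2 (fun _ : Fin m => E) :=
  (PiLp.continuousLinearEquiv 2 ℂ (fun _ : Fin m => E)).symm.toContinuousLinearMap ∘L
    ContinuousLinearMap.pi fun a => ∑ b, A a b ∘L PiLp.proj 2 (fun _ : Fin m => E) b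

theorem matOp_apply (A : Matrix (Fin m) (Fin m) (E →L[ℂ] E)) (u : PiLp 2 (fun _ : Fin m => E))
    (a : Fin m) : matOp A u a = ∑ b, A a b (u b) := by
  simp [matOp]

theorem norm_matOp_apply_sq (A : Matrix (Fin m) (Fin m) (E →L[ℂ] E))
    (u : PiLp 2 (fun _ : Fin m => E)) : ‖matOp A u‖ ^ 2 = ∑ a, ‖∑ b, A a b (u b)‖ ^ 2 := by
  rw [PiLp.norm_sq_eq_of_L2]
  simp [matOp_apply]

theorem norm_matOp_le_iff (A : Matrix (Fin m) (Fin m) (E →L[ℂ] E)) {c : ℝ} (hc : 0 ≤ c) :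
    ‖matOp A‖ ≤ c ↔ ∀ u : Fin m → E, ∑ a, ‖∑ b, A a b (u b)‖ ^ 2 ≤ c ^ 2 * ∑ b, ‖u b‖ ^ 2 := by
  have h1 : ∀ u : PiLp 2 (fun _ : Fin m => E), ‖matOp A u‖ ≤ c * ‖u‖ ↔
      ∑ a, ‖∑ b, A a b (u b)‖ ^ 2 ≤ c ^ 2 * ∑ b, ‖u b‖ ^ 2 := fun u => by
    rw [← norm_matOp_apply_sq, ← PiLp.norm_sq_eq_of_L2, ← mul_pow,
      sq_le_sq₀ (norm_nonneg _) (by positivity)]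
  rw [ContinuousLinearMap.opNorm_le_iff hc]
  exact ⟨fun h u => (h1 (WithLp.toLp 2 u)).1 (h _), fun h u => (h1 u).2 (h u)⟩

set_option synthInstance.maxHeartbeats 200000 in
theorem continuous_matOp :
    Continuous (matOp : Matrix (Fin m) (Fin m) (E →L[ℂ] E) → _) := by
  have : ∀ A : Matrix (Fin m) (Fin m) (E →L[ℂ] E), matOp A =
      ∑ a, ∑ b, (PiLp.continuousLinearEquiv 2 ℂ (fun _ : Fin m => E)).symm.toContinuousLinearMap ∘L
        (ContinuousLinearMap.single ℂ (fun _ : Fin m => E) a) ∘L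
        A a b ∘L PiLp.proj 2 (fun _ : Fin m => E) b := fun A => by
    ext u a
    rw [matOp_apply]
    simp [Pi.single_apply, Finset.sum_apply]
  rw [funext this]
  refine continuous_finsetSum _ fun a _ => continuous_finsetSum _ fun b _ => ?_
  have h1 : Continuous fun A : Matrix (Fin m) (Fin m) (E →L[ℂ] E) => A a b :=
    (continuous_apply b).comp (continuous_apply a)
  exact continuous_const.clm_comp (continuous_const.clm_comp (h1.clm_comp continuous_const))

end MatOp

variable {H : Type*} [NormedAddCommGroup H] [InnerProductSpace ℂ H] [CompleteSpace H]

/-- A homomorphism from `𝔩_n` is completely contractive if, for every `m`, its entrywise action on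
`m × m` matrices over `𝔩_n` does not increase the operator norm. -/
def IsCompletelyContractive (ρ : normAlg n →ₐ[ℂ] (H →L[ℂ] H)) : Prop :=
  ∀ (m : ℕ) (A : Matrix (Fin m) (Fin m) (normAlg n)),
    ‖matOp (A.map fun a => ρ a)‖ ≤ ‖matOp (A.map fun a => (a : Fock n →L[ℂ] Fock n))‖

theorem IsCompletelyContractive.norm_le {ρ : normAlg n →ₐ[ℂ] (H →L[ℂ] H)}
    (h : IsCompletelyContractive ρ) (A : normAlg n) : ‖ρ A‖ ≤ ‖A‖ := by
  have h1 := h 1 (Matrix.of fun _ _ => A)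
  have h2 : ‖matOp ((Matrix.of fun _ _ => A : Matrix (Fin 1) (Fin 1) (normAlg n)).map
      fun a => (a : Fock n →L[ℂ] Fock n))‖ ≤ ‖A‖ := by
    refine (norm_matOp_le_iff _ (norm_nonneg (A : Fock n →L[ℂ] Fock n))).2 ?_
    intro u
    simp only [Matrix.map_apply, Matrix.of_apply, Finset.univ_unique, Finset.sum_singleton, ← mul_pow]
    have := (A : Fock n →L[ℂ] Fock n).le_opNorm (u default)
    gcongr
  have h3 := (norm_matOp_le_iff _ (norm_nonneg _)).1 (h1.trans h2)
  refine ContinuousLinearMap.opNorm_le_bound _ (norm_nonneg _) fun x => ?_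
  have h4 := h3 fun _ => x
  simp only [Matrix.map_apply, Matrix.of_apply, Finset.univ_unique, Finset.sum_singleton, ← mul_pow] at h4
  exact (sq_le_sq₀ (norm_nonneg _) (by positivity)).1 h4

section Slice
variable {E : Type*} [NormedAddCommGroup E] [InnerProductSpace ℂ E] [CompleteSpace E]

/-- The operator `u ↦ ∑_w ⟪f, u_w⟫ e_w`. -/
noncomputable def slice (f : E) : FockTensor n E →L[ℂ] Fock n := adjoint (tmulLeft f)

theorem slice_apply (f : E) (u : FockTensor n E) (w : Word n) : slice f u w = ⟪f, u w⟫_ℂ := by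
  have h1 : ⟪(basisVec w : Fock n), slice f u⟫_ℂ = slice f u w := by
    rw [basisVec, lp.inner_single_left]; simp
  have h2 : tmulLeft f (basisVec w) = lp.single 2 w f := tmul_basisVec w f
  rw [← h1, slice, ContinuousLinearMap.adjoint_inner_right, h2, lp.inner_single_left]

theorem slice_creation (f : E) (i : Fin n) (u : FockTensor n E) :
    slice f (creation i u) = L i (slice f u) := by
  have : slice f ∘L creation i = L i ∘L slice (n := n) f := by
    refine clm_ext fun w x => ?_
    have hs : ∀ v : Word n, slice f (lp.single 2 v x) = ⟪f, x⟫_ℂ • basisVec v := fun v => by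
      refine lp.ext (funext fun v' => ?_)
      rw [slice_apply]
      by_cases hv : v' = v
      · subst hv; simp [basisVec]
      · simp [basisVec, hv]
    simp only [ContinuousLinearMap.comp_apply, creation_single, hs, map_smul, L_basisVec]
  exact congrArg (fun A => A u) this

theorem ofReal_norm_sq_lp {ι : Type*} {G : ι → Type*} [∀ i, NormedAddCommGroup (G i)]
    (u : lp G 2) : ENNReal.ofReal (‖u‖ ^ 2) = ∑' i, ENNReal.ofReal (‖u i‖ ^ 2) := by
  have h := lp.hasSum_norm (p := 2) (by simp) u
  simp only [ENNReal.toReal_ofNat, Real.rpow_ofNat] at h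
  rw [← h.tsum_eq, ENNReal.ofReal_tsum_of_nonneg (fun i => by positivity) h.summable]

theorem slice_parseval {ι : Type*} (b : HilbertBasis ι ℂ E) (u : FockTensor n E) :
    ENNReal.ofReal (‖u‖ ^ 2) = ∑' j, ENNReal.ofReal (‖slice (b j) u‖ ^ 2) := by
  have h1 : ∀ x : E, ENNReal.ofReal (‖x‖ ^ 2) = ∑' j, ENNReal.ofReal (‖⟪b j, x⟫_ℂ‖ ^ 2) := fun x => by
    rw [← LinearIsometryEquiv.norm_map b.repr x, ofReal_norm_sq_lp]
    simp [b.repr_apply_apply]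
  simp only [ofReal_norm_sq_lp (G := fun _ : Word n => ℂ), slice_apply]
  rw [ofReal_norm_sq_lp, ENNReal.tsum_comm]
  exact tsum_congr fun w => h1 _

/-- Evaluation of noncommutative polynomials. -/
noncomputable abbrev ev {A : Type*} [Ring A] [Algebra ℂ A] (T : Fin n → A) :
    FreeAlgebra ℂ (Fin n) →ₐ[ℂ] A := FreeAlgebra.lift ℂ T

theorem slice_ev (f : E) (p : FreeAlgebra ℂ (Fin n)) (u : FockTensor n E) :
    slice f (ev creation p u) = ev L p (slice f u) := by
  induction p using FreeAlgebra.induction generalizing u with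
  | grade0 r => simp [Algebra.algebraMap_eq_smul_one]
  | grade1 i => simp [ev, slice_creation]
  | mul p q hp hq => simp [hp, hq]
  | add p q hp hq => simp [hp, hq]

theorem norm_matOp_creation_le {m : ℕ} (P : Matrix (Fin m) (Fin m) (FreeAlgebra ℂ (Fin n))) :
    ‖matOp (P.map fun p => ev (creation : Fin n → FockTensor n E →L[ℂ] FockTensor n E) p)‖ ≤
      ‖matOp (P.map fun p => ev L p)‖ := by
  rw [norm_matOp_le_iff _ (norm_nonneg _)]
  intro u
  have hL := (norm_matOp_le_iff (P.map fun p => ev L p) (norm_nonneg _)).1 le_rfl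
  set c := ‖matOp (P.map fun p => ev L p)‖
  obtain ⟨s, b, -⟩ := exists_hilbertBasis ℂ E
  have key : ENNReal.ofReal (∑ a, ‖∑ d, ev creation (P a d) (u d)‖ ^ 2) ≤
      ENNReal.ofReal (c ^ 2 * ∑ d, ‖u d‖ ^ 2) := by
    rw [ENNReal.ofReal_sum_of_nonneg fun _ _ => by positivity, ENNReal.ofReal_mul (by positivity),
      ENNReal.ofReal_sum_of_nonneg fun _ _ => by positivity]
    simp only [slice_parseval b]
    rw [← Summable.tsum_finsetSum fun _ _ => ENNReal.summable,
      ← Summable.tsum_finsetSum fun _ _ => ENNReal.summable, ← ENNReal.tsum_mul_left]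
    refine ENNReal.tsum_le_tsum fun j => ?_
    rw [← ENNReal.ofReal_sum_of_nonneg fun _ _ => by positivity,
      ← ENNReal.ofReal_sum_of_nonneg fun _ _ => by positivity,
      ← ENNReal.ofReal_mul (by positivity)]
    refine ENNReal.ofReal_le_ofReal ?_
    have := hL fun d => slice (b j) (u d)
    simpa only [map_sum, slice_ev, Matrix.map_apply] using this
  exact (ENNReal.ofReal_le_ofReal_iff (by positivity)).1 key

end Slice

namespace RowContraction
variable (T : RowContraction n H)

theorem adjoint_creation_apply {E : Type*} [NormedAddCommGroup E] [InnerProductSpace ℂ E]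
    [CompleteSpace E] (i : Fin n) (u : FockTensor n E) (w : Word n) :
    adjoint (creation i) u w = u (FreeMonoid.of i * w) := by
  refine ext_inner_left ℂ fun x => ?_
  rw [← lp.inner_single_left (𝕜 := ℂ) (G := fun _ : Word n => E) w x,
    ContinuousLinearMap.adjoint_inner_right, creation_single, lp.inner_single_left]

theorem poissonKernel_adjoint (i : Fin n) (h : H) :
    T.poissonKernel (adjoint (T.op i) h) = adjoint (creation i) (T.poissonKernel h) := by
  refine lp.ext (funext fun w => Subtype.ext ?_)
  rw [adjoint_creation_apply, poissonKernel_apply, poissonKernel_apply]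
  simp only [word, map_mul, FreeMonoid.lift_eval_of]
  rw [ContinuousLinearMap.mul_def, ContinuousLinearMap.adjoint_comp]
  rfl

theorem adjoint_poissonKernel_creation (i : Fin n) (u : FockTensor n T.defectStar) :
    adjoint T.poissonKernel (creation i u) = T.op i (adjoint T.poissonKernel u) := by
  refine ext_inner_right ℂ fun h => ?_
  rw [ContinuousLinearMap.adjoint_inner_left, ← ContinuousLinearMap.adjoint_inner_right
      (creation i : FockTensor n T.defectStar →L[ℂ] FockTensor n T.defectStar),
    ← poissonKernel_adjoint, ← ContinuousLinearMap.adjoint_inner_left,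
    ContinuousLinearMap.adjoint_inner_right]

theorem adjoint_poissonKernel_ev (p : FreeAlgebra ℂ (Fin n)) (u : FockTensor n T.defectStar) :
    adjoint T.poissonKernel (ev creation p u) = ev T.op p (adjoint T.poissonKernel u) := by
  induction p using FreeAlgebra.induction generalizing u with
  | grade0 r => simp [Algebra.algebraMap_eq_smul_one]
  | grade1 i => simp [ev, adjoint_poissonKernel_creation]
  | mul p q hp hq => simp [hp, hq]
  | add p q hp hq => simp [hp, hq]

theorem norm_poissonKernel_of_strict {r : ℝ} (hr0 : 0 ≤ r) (hr : r < 1)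
    (hT : ∀ h, ‖adjoint T.row h‖ ^ 2 ≤ r * ‖h‖ ^ 2) (h : H) : ‖T.poissonKernel h‖ = ‖h‖ := by
  refine le_antisymm (norm_le_of_sum_sq (norm_nonneg _) (T.sum_poissonCoord_le h)) ?_
  let x : List (Fin n) → ℝ := fun l => ‖T.state h 0 l‖ ^ 2
  let y : List (Fin n) → ℝ := fun l => ‖T.output h 0 (FreeMonoid.ofList l.reverse)‖ ^ 2
  have hbal : ∀ l, y l + ∑ i, x (i :: l) = x l := fun l => by
    have := T.halmos (T.state h 0 l) 0
    rw [PiLp.norm_sq_eq_of_L2 _ (adjoint T.row _ + _)] at this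
    simpa [output, x, y, state] using this
  have hdec : ∀ N, ∑ l ∈ level n N, x l ≤ r ^ N * ‖h‖ ^ 2 := fun N => by
    induction N with
    | zero => simp [level, x, state]
    | succ N ih =>
      rw [sum_level_succ, pow_succ', mul_assoc]
      refine le_trans ?_ (mul_le_mul_of_nonneg_left ih hr0)
      rw [Finset.mul_sum]
      refine Finset.sum_le_sum fun l _ => ?_
      have := hT (T.state h 0 l)
      rw [PiLp.norm_sq_eq_of_L2] at this
      simpa [x, state] using this
  have hkey : ∀ N, ∑ k ∈ Finset.range N, ∑ l ∈ level n k, y l + ∑ l ∈ level n N, x l = x [] := by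
    intro N
    induction N with
    | zero => simp [level]
    | succ N ih =>
      rw [Finset.sum_range_succ, sum_level_succ, ← ih, add_assoc, ← Finset.sum_add_distrib,
        Finset.sum_congr rfl (fun l _ => hbal l)]
  have hle : ∀ N, ‖h‖ ^ 2 ≤ ‖T.poissonKernel h‖ ^ 2 + r ^ N * ‖h‖ ^ 2 := fun N => by
    have h1 := hkey N
    have h2 := hdec N
    have h3 : ∑ k ∈ Finset.range N, ∑ l ∈ level n k, y l ≤ ‖T.poissonKernel h‖ ^ 2 := by
      rw [← Finset.sum_biUnion (level_disjoint.subset (Set.subset_univ _))]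
      let r : List (Fin n) ≃ Word n :=
        ⟨fun l => FreeMonoid.ofList l.reverse, fun w => w.toList.reverse,
          fun l => by simp, fun w => by simp⟩
      have := sum_sq_le (T.poissonKernel h) (((Finset.range N).biUnion (level n)).map r.toEmbedding)
      rw [Finset.sum_map] at this
      refine le_trans (le_of_eq (Finset.sum_congr rfl fun l _ => ?_)) this
      change ‖T.output h 0 (r l)‖ ^ 2 = ‖T.poissonCoord h (r l)‖ ^ 2
      rw [output_zero_right]
      rfl
    have h4 : x [] = ‖h‖ ^ 2 := rfl
    linarith
  have hlim : Filter.Tendsto (fun N : ℕ => ‖T.poissonKernel h‖ ^ 2 + r ^ N * ‖h‖ ^ 2) Filter.atTop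
      (nhds (‖T.poissonKernel h‖ ^ 2 + 0 * ‖h‖ ^ 2)) :=
    ((tendsto_pow_atTop_nhds_zero_of_lt_one hr0 hr).mul_const _).const_add _
  have := ge_of_tendsto' hlim hle
  rw [zero_mul, add_zero] at this
  exact (sq_le_sq₀ (norm_nonneg _) (norm_nonneg _)).1 this

theorem vonNeumann_of_strict {r : ℝ} (hr0 : 0 ≤ r) (hr : r < 1)
    (hT : ∀ h, ‖adjoint T.row h‖ ^ 2 ≤ r * ‖h‖ ^ 2) {m : ℕ}
    (P : Matrix (Fin m) (Fin m) (FreeAlgebra ℂ (Fin n))) :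
    ‖matOp (P.map fun p => ev T.op p)‖ ≤ ‖matOp (P.map fun p => ev L p)‖ := by
  have hK := T.norm_poissonKernel_of_strict hr0 hr hT
  have hiso : ∀ h, adjoint T.poissonKernel (T.poissonKernel h) = h := fun h => by
    have := (ContinuousLinearMap.norm_map_iff_adjoint_comp_self T.poissonKernel).1 hK
    exact congrArg (fun A => A h) this
  have hcon : ∀ u, ‖adjoint T.poissonKernel u‖ ≤ ‖u‖ := norm_adjoint_le fun h => (hK h).le
  rw [norm_matOp_le_iff _ (norm_nonneg _)]
  intro u
  have h1 := (norm_matOp_le_iff _ (norm_nonneg _)).1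
    (norm_matOp_creation_le (E := T.defectStar) P) fun d => T.poissonKernel (u d)
  simp only [hK, Matrix.map_apply] at h1 ⊢
  refine le_trans (Finset.sum_le_sum fun a _ => ?_) h1
  have h2 : ∑ d, ev T.op (P a d) (u d) =
      adjoint T.poissonKernel (∑ d, ev creation (P a d) (T.poissonKernel (u d))) := by
    simp only [map_sum, adjoint_poissonKernel_ev, hiso]
  rw [h2]
  gcongr
  exact hcon _

theorem continuous_ev_smul (p : FreeAlgebra ℂ (Fin n)) :
    Continuous fun r : ℝ => ev (fun i => (r : ℂ) • T.op i) p := by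
  induction p using FreeAlgebra.induction with
  | grade0 r => simp only [AlgHom.commutes]; exact continuous_const
  | grade1 i =>
    simp only [ev, FreeAlgebra.lift_ι_apply]
    exact Complex.continuous_ofReal.smul continuous_const
  | mul p q hp hq => simp only [map_mul]; exact hp.mul hq
  | add p q hp hq => simp only [map_add]; exact hp.add hq

/-- The row contraction `r T`. -/
noncomputable def scale (r : ℝ) (hr : ‖(r : ℂ)‖ ≤ 1) : RowContraction n H where
  op i := (r : ℂ) • T.op i
  sum_le := by
    rw [sum_le_one_iff]
    intro u
    have : rowOp (fun i => (r : ℂ) • T.op i) u = (r : ℂ) • T.row u := by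
      simp [rowOp_apply, row, Finset.smul_sum]
    rw [this, norm_smul]
    calc _ ≤ 1 * ‖u‖ := mul_le_mul hr (T.norm_row_le u) (norm_nonneg _) zero_le_one
      _ = _ := one_mul _

theorem vonNeumann {m : ℕ} (P : Matrix (Fin m) (Fin m) (FreeAlgebra ℂ (Fin n))) :
    ‖matOp (P.map fun p => ev T.op p)‖ ≤ ‖matOp (P.map fun p => ev L p)‖ := by
  have hcont : Continuous fun r : ℝ =>
      ‖matOp (P.map fun p => ev (fun i => (r : ℂ) • T.op i) p)‖ := by
    refine (continuous_matOp.comp ?_).norm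
    refine continuous_pi fun a => continuous_pi fun b => ?_
    exact T.continuous_ev_smul (P a b)
  have hlim : Filter.Tendsto (fun r : ℝ =>
      ‖matOp (P.map fun p => ev (fun i => (r : ℂ) • T.op i) p)‖) (nhdsWithin 1 (Set.Iio 1))
      (nhds ‖matOp (P.map fun p => ev T.op p)‖) := by
    have := (hcont.tendsto 1).mono_left (nhdsWithin_le_nhds (s := Set.Iio (1 : ℝ)))
    simpa using this
  refine le_of_tendsto hlim ?_
  have hmem : Set.Ioo (0 : ℝ) 1 ∈ nhdsWithin (1 : ℝ) (Set.Iio 1) :=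
    Ioo_mem_nhdsLT zero_lt_one
  filter_upwards [hmem] with r hr
  have hr1 : ‖(r : ℂ)‖ ≤ 1 := by
    rw [Complex.norm_real, Real.norm_of_nonneg hr.1.le]; exact hr.2.le
  refine (T.scale r hr1).vonNeumann_of_strict (r := r ^ 2) (by positivity)
    (by nlinarith [hr.1, hr.2]) (fun h => ?_) P
  have : adjoint (T.scale r hr1).row h = (r : ℂ) • adjoint T.row h := by
    ext i
    rw [PiLp.smul_apply, row, row, adjoint_rowOp_apply, adjoint_rowOp_apply, scale, map_smulₛₗ,
      Complex.conj_ofReal]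
    rfl
  rw [this, norm_smul, mul_pow, Complex.norm_real, Real.norm_of_nonneg hr.1.le]
  have := norm_adjoint_le T.norm_row_le h
  gcongr

/-- `ρ` is the functional calculus of `T`: the completely contractive homomorphism that maps `L_i` to
`T_i`. -/
structure IsFunctionalCalculus (ρ : normAlg n →ₐ[ℂ] (H →L[ℂ] H)) : Prop where
  completelyContractive : IsCompletelyContractive ρ
  map_L : ∀ i, ρ ⟨L i, L_mem_normAlg i⟩ = T.op i

theorem ev_L_mem (p : FreeAlgebra ℂ (Fin n)) : ev L p ∈ normAlg n := by
  induction p using FreeAlgebra.induction with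
  | grade0 r => rw [AlgHom.commutes]; exact (normAlg n).algebraMap_mem r
  | grade1 i => rw [ev, FreeAlgebra.lift_ι_apply]; exact L_mem_normAlg i
  | mul p q hp hq => rw [map_mul]; exact mul_mem hp hq
  | add p q hp hq => rw [map_add]; exact add_mem hp hq

/-- polynomials in `L` as elements of the norm closed algebra -/
noncomputable def polyL : FreeAlgebra ℂ (Fin n) →ₐ[ℂ] normAlg n :=
  (ev L).codRestrict (normAlg n) ev_L_mem

theorem coe_polyL (p : FreeAlgebra ℂ (Fin n)) : (polyL p : Fock n →L[ℂ] Fock n) = ev L p := rfl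

theorem denseRange_polyL : DenseRange (polyL : FreeAlgebra ℂ (Fin n) →ₐ[ℂ] normAlg n) := by
  intro A
  rw [closure_subtype]
  have hA : (A : Fock n →L[ℂ] Fock n) ∈
      closure ((Algebra.adjoin ℂ (Set.range L) : Subalgebra ℂ (Fock n →L[ℂ] Fock n)) :
        Set (Fock n →L[ℂ] Fock n)) := A.2
  refine closure_mono ?_ hA
  intro B hB
  have : B ∈ (ev L : FreeAlgebra ℂ (Fin n) →ₐ[ℂ] _).range := by
    rw [← Algebra.adjoin_range_eq_range_freeAlgebra_lift]
    exact hB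
  obtain ⟨p, rfl⟩ := this
  exact ⟨polyL p, ⟨p, rfl⟩, rfl⟩

theorem norm_ev_le (p : FreeAlgebra ℂ (Fin n)) : ‖ev T.op p‖ ≤ 1 * ‖polyL p‖ := by
  rw [one_mul]
  have h1 := T.vonNeumann (m := 1) (Matrix.of fun _ _ => p)
  have h2 : ‖matOp ((Matrix.of fun _ _ => p : Matrix (Fin 1) (Fin 1) (FreeAlgebra ℂ (Fin n))).map
      fun p => ev L p)‖ ≤ ‖polyL p‖ := by
    refine (norm_matOp_le_iff _ (norm_nonneg (polyL p : Fock n →L[ℂ] Fock n))).2 ?_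
    intro u
    simp only [Matrix.map_apply, Matrix.of_apply, Finset.univ_unique, Finset.sum_singleton, ← mul_pow]
    have := (polyL p : Fock n →L[ℂ] Fock n).le_opNorm (u default)
    gcongr
    exact this
  have h3 := (norm_matOp_le_iff _ (norm_nonneg _)).1 (h1.trans h2)
  refine ContinuousLinearMap.opNorm_le_bound _ (norm_nonneg _) fun x => ?_
  have h4 := h3 fun _ => x
  simp only [Matrix.map_apply, Matrix.of_apply, Finset.univ_unique, Finset.sum_singleton, ← mul_pow] at h4
  exact (sq_le_sq₀ (norm_nonneg _) (by positivity)).1 h4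

noncomputable def calcCLM : normAlg n →L[ℂ] (H →L[ℂ] H) :=
  (ev T.op).toLinearMap.extendOfNorm (polyL (n := n)).toLinearMap

theorem calcCLM_polyL (p : FreeAlgebra ℂ (Fin n)) : T.calcCLM (polyL p) = ev T.op p :=
  LinearMap.extendOfNorm_eq (f := (ev T.op).toLinearMap) (e := (polyL (n := n)).toLinearMap)
    denseRange_polyL ⟨1, T.norm_ev_le⟩ p

noncomputable def calc₀ : normAlg n →ₐ[ℂ] (H →L[ℂ] H) :=
  AlgHom.ofLinearMap T.calcCLM.toLinearMap
    (by
      have := T.calcCLM_polyL 1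
      simpa using this)
    (by
      intro A B
      refine denseRange_polyL.induction_on₂ (p := fun A B => T.calcCLM (A * B) =
        T.calcCLM A * T.calcCLM B) ?_ (fun p q => ?_) A B
      · refine isClosed_eq ?_ ?_
        · exact T.calcCLM.continuous.comp (continuous_fst.mul continuous_snd)
        · exact (T.calcCLM.continuous.comp continuous_fst).mul
            (T.calcCLM.continuous.comp continuous_snd)
      · rw [← map_mul, calcCLM_polyL, calcCLM_polyL, calcCLM_polyL, map_mul])

theorem isFunctionalCalculus_calc₀ : T.IsFunctionalCalculus T.calc₀ where
  completelyContractive m A := by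
    have hd := DenseRange.piMap (fun _ : Fin m => DenseRange.piMap fun _ : Fin m =>
      (denseRange_polyL (n := n)))
    refine hd.induction_on (p := fun A : Fin m → Fin m → normAlg n =>
      ‖matOp (Matrix.map A fun a => T.calc₀ a)‖ ≤
        ‖matOp (Matrix.map A fun a => (a : Fock n →L[ℂ] Fock n))‖) A ?_ fun P => ?_
    · refine isClosed_le (continuous_matOp.comp ?_).norm (continuous_matOp.comp ?_).norm
      · exact continuous_pi fun a => continuous_pi fun b =>
          T.calcCLM.continuous.comp ((continuous_apply b).comp (continuous_apply a))
      · exact continuous_pi fun a => continuous_pi fun b =>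
          continuous_subtype_val.comp ((continuous_apply b).comp (continuous_apply a))
    · have := T.vonNeumann P
      have h1 : Matrix.map (Pi.map (fun _ => Pi.map fun _ => polyL) P) (fun a => T.calc₀ a) =
          Matrix.map P fun p => ev T.op p := by
        refine Matrix.ext fun a b => ?_
        exact T.calcCLM_polyL (P a b)
      rw [h1]
      exact this
  map_L i := by
    have h : (⟨L i, L_mem_normAlg i⟩ : normAlg n) = polyL (FreeAlgebra.ι ℂ i) :=
      Subtype.ext (by simp [coe_polyL, ev])
    rw [h]
    refine (T.calcCLM_polyL _).trans ?_
    simp [ev]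

theorem existsUnique_functionalCalculus :
    ∃! ρ : normAlg n →ₐ[ℂ] (H →L[ℂ] H), T.IsFunctionalCalculus ρ := by
  refine ⟨T.calc₀, T.isFunctionalCalculus_calc₀, fun ρ hρ => ?_⟩
  have hc : Continuous ρ := by
    refine (LinearMap.mkContinuous ρ.toLinearMap 1 fun A => ?_).continuous
    rw [one_mul]
    exact hρ.completelyContractive.norm_le A
  refine AlgHom.ext fun A => congrFun (denseRange_polyL.equalizer hc T.calcCLM.continuous ?_) A
  have h : ρ.comp polyL = ev T.op := by
    ext i : 2
    have h : polyL (FreeAlgebra.ι ℂ i) = (⟨L i, L_mem_normAlg i⟩ : normAlg n) :=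
      Subtype.ext (by simp [coe_polyL, ev])
    simp only [Function.comp_apply, AlgHom.comp_apply, h, hρ.map_L, AlgHom.coe_comp]
    simp [ev]
  funext p
  exact (congrArg (fun f => f p) h).trans (T.calcCLM_polyL p).symm

/-- The functional calculus `ρ_T` of the row contraction `T` on `𝔩_n`. -/
noncomputable def functionalCalculus : normAlg n →ₐ[ℂ] (H →L[ℂ] H) :=
  T.existsUnique_functionalCalculus.choose

end RowContraction
end Calculus

section Voiculescu

variable {n : ℕ}

open Matrix

variable (n) in
/-- The signature matrix `J = diag(-1, 1, …, 1)` -/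
def sgn : Matrix (Fin (n + 1)) (Fin (n + 1)) ℂ := Matrix.diagonal (Fin.cons (-1) fun _ => 1)

variable (n) in
/-- The group `U(1,n)` of matrices with `X* J X = J`. -/
def U1Subgroup : Subgroup (GL (Fin (n + 1)) ℂ) where
  carrier := {X | (X : Matrix (Fin (n + 1)) (Fin (n + 1)) ℂ)ᴴ * sgn n * X = sgn n}
  one_mem' := by simp
  mul_mem' {X Y} hX hY := by
    have hX' : (X : Matrix (Fin (n + 1)) (Fin (n + 1)) ℂ)ᴴ * sgn n * X = sgn n := hX
    have hY' : (Y : Matrix (Fin (n + 1)) (Fin (n + 1)) ℂ)ᴴ * sgn n * Y = sgn n := hY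
    change ((X * Y : GL (Fin (n + 1)) ℂ) : Matrix (Fin (n + 1)) (Fin (n + 1)) ℂ)ᴴ * sgn n *
      (X * Y : GL (Fin (n + 1)) ℂ) = sgn n
    rw [Units.val_mul, Matrix.conjTranspose_mul]
    calc _ = (Y : Matrix (Fin (n + 1)) (Fin (n + 1)) ℂ)ᴴ *
          ((X : Matrix (Fin (n + 1)) (Fin (n + 1)) ℂ)ᴴ * sgn n * X) * Y := by
          simp only [Matrix.mul_assoc]
      _ = _ := by rw [hX', hY']
  inv_mem' {X} hX := by
    have hX' : (X : Matrix (Fin (n + 1)) (Fin (n + 1)) ℂ)ᴴ * sgn n * X = sgn n := hX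
    change ((X⁻¹ : GL (Fin (n + 1)) ℂ) : Matrix (Fin (n + 1)) (Fin (n + 1)) ℂ)ᴴ * sgn n *
      (X⁻¹ : GL (Fin (n + 1)) ℂ) = sgn n
    have h1 : (X : Matrix (Fin (n + 1)) (Fin (n + 1)) ℂ) * (X⁻¹ : GL (Fin (n + 1)) ℂ) = 1 :=
      X.mul_inv
    have h2 := congrArg Matrix.conjTranspose h1
    rw [Matrix.conjTranspose_mul, Matrix.conjTranspose_one] at h2
    nth_rewrite 1 [← hX']
    calc _ = (((X⁻¹ : GL (Fin (n + 1)) ℂ) : Matrix (Fin (n + 1)) (Fin (n + 1)) ℂ)ᴴ *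
          (X : Matrix (Fin (n + 1)) (Fin (n + 1)) ℂ)ᴴ) * sgn n *
          ((X : Matrix (Fin (n + 1)) (Fin (n + 1)) ℂ) * (X⁻¹ : GL (Fin (n + 1)) ℂ)) := by
          simp only [Matrix.mul_assoc]
      _ = _ := by rw [h1, h2, Matrix.one_mul, Matrix.mul_one]

variable (n) in
/-- The group `U(1,n)`. -/
abbrev U1 : Type := U1Subgroup n

namespace U1

variable (X : U1 n)

/-- The underlying matrix `X`, whose blocks are `x` (a scalar), `y` (a row), `z` (the entries of the
first column) and `X'`. -/
def mat : Matrix (Fin (n + 1)) (Fin (n + 1)) ℂ := (X : GL (Fin (n + 1)) ℂ)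
/-- The scalar `x = X_{00}`. -/
def x : ℂ := X.mat 0 0
/-- The row `y`. -/
def y (j : Fin n) : ℂ := X.mat 0 j.succ
/-- The entries of the column `zᵗ`. -/
def z (i : Fin n) : ℂ := X.mat i.succ 0
/-- The lower right `n × n` block of `X`. -/
def X' : Matrix (Fin n) (Fin n) ℂ := Matrix.of fun i j => X.mat i.succ j.succ

theorem mat_mul_inv : X.mat * (X⁻¹).mat = 1 := (X : GL (Fin (n + 1)) ℂ).mul_inv

theorem inner_preserving {F : Type*} [NormedAddCommGroup F] [InnerProductSpace ℂ F]
    (a b : Fin (n + 1) → F) :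
    -⟪∑ j, X.mat 0 j • a j, ∑ j, X.mat 0 j • b j⟫_ℂ +
      ∑ i : Fin n, ⟪∑ j, X.mat i.succ j • a j, ∑ j, X.mat i.succ j • b j⟫_ℂ =
    -⟪a 0, b 0⟫_ℂ + ∑ i : Fin n, ⟪a i.succ, b i.succ⟫_ℂ := by
  let s : Fin (n + 1) → ℂ := Fin.cons (-1) fun _ => 1
  have hs : ∀ f : Fin (n + 1) → ℂ, ∑ i, s i * f i = -f 0 + ∑ i : Fin n, f i.succ := fun f => by
    rw [Fin.sum_univ_succ]; simp [s]
  rw [← hs fun i => ⟪∑ j, X.mat i j • a j, ∑ j, X.mat i j • b j⟫_ℂ, ← hs fun i => ⟪a i, b i⟫_ℂ]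
  have hX : X.matᴴ * sgn n * X.mat = sgn n := X.2
  have hent : ∀ j k, ∑ i, s i * (star (X.mat i j) * X.mat i k) = if j = k then s j else 0 := by
    intro j k
    have := congrFun (congrFun hX j) k
    rw [sgn, Matrix.mul_apply, Matrix.diagonal_apply] at this
    simp only [Matrix.mul_diagonal, Matrix.conjTranspose_apply] at this
    rw [← this]
    exact Finset.sum_congr rfl fun i _ => by ring
  calc ∑ i, s i * ⟪∑ j, X.mat i j • a j, ∑ j, X.mat i j • b j⟫_ℂ
      = ∑ i, ∑ j, ∑ k, (s i * (star (X.mat i j) * X.mat i k)) * ⟪a j, b k⟫_ℂ := by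
        refine Finset.sum_congr rfl fun i _ => ?_
        rw [sum_inner, Finset.mul_sum]
        refine Finset.sum_congr rfl fun j _ => ?_
        rw [inner_sum, Finset.mul_sum]
        refine Finset.sum_congr rfl fun k _ => ?_
        rw [inner_smul_left, inner_smul_right]
        simp only [starRingEnd_apply]
        ring
    _ = ∑ j, ∑ k, (∑ i, s i * (star (X.mat i j) * X.mat i k)) * ⟪a j, b k⟫_ℂ := by
        rw [Finset.sum_comm]
        refine Finset.sum_congr rfl fun j _ => ?_
        rw [Finset.sum_comm]
        exact Finset.sum_congr rfl fun k _ => (Finset.sum_mul _ _ _).symm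
    _ = _ := by
        simp only [hent, ite_mul, zero_mul, Finset.sum_ite_eq, Finset.mem_univ, if_true]

theorem norm_x_sq : ‖X.x‖ ^ 2 = 1 + ∑ i, ‖X.z i‖ ^ 2 := by
  have h := X.inner_preserving (F := ℂ) (Pi.single 0 1) (Pi.single 0 1)
  have hc : ∀ i, ∑ j, X.mat i j • (Pi.single 0 1 : Fin (n + 1) → ℂ) j = X.mat i 0 := fun i => by
    simp [Pi.single_apply]
  simp only [hc, inner_self_eq_norm_sq_to_K, Pi.single_eq_same,
    Pi.single_eq_of_ne (Fin.succ_ne_zero _), norm_one, norm_zero] at h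
  have h2 : -‖X.mat 0 0‖ ^ 2 + ∑ i : Fin n, ‖X.mat i.succ 0‖ ^ 2 = -1 := by
    have h3 := congrArg Complex.re h
    simpa [← Complex.ofReal_pow] using h3
  simp only [x, z]
  linarith

section Moebius
variable {A : Type*} [Ring A] [Algebra ℂ A] (T : Fin n → A)

/-- `x - T[z]` -/
def den : A := X.x • 1 - ∑ i, X.z i • T i

/-- `T[X' e_j] - y_j` -/
def num (j : Fin n) : A := (∑ i, X.X' i j • T i) - X.y j • 1

/-- Auxiliary: the column `(1, -T_1, …, -T_n)`. -/
def homog (T : Fin n → A) : Fin (n + 1) → A := Fin.cons 1 fun k => - T k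

theorem den_eq : X.den T = ∑ i, X.mat i 0 • homog T i := by
  rw [Fin.sum_univ_succ]; simp [den, homog, x, z, sub_eq_add_neg]

theorem num_eq (j : Fin n) : -X.num T j = ∑ i, X.mat i j.succ • homog T i := by
  rw [Fin.sum_univ_succ]; simp [num, homog, X', y, sub_eq_add_neg]

theorem homog_col (c : Fin (n + 1) → ℂ) :
    c 0 • X.den T - ∑ k : Fin n, c k.succ • X.num T k = ∑ i, (X.mat *ᵥ c) i • homog T i := by
  have : c 0 • X.den T - ∑ k : Fin n, c k.succ • X.num T k =
      ∑ j, c j • ∑ i, X.mat i j • homog T i := by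
    rw [Fin.sum_univ_succ, ← den_eq, sub_eq_add_neg, ← Finset.sum_neg_distrib]
    simp only [← num_eq, smul_neg]
  rw [this]
  simp only [Finset.smul_sum, Matrix.mulVec, dotProduct, Finset.sum_smul, smul_smul]
  rw [Finset.sum_comm]
  simp only [mul_comm]

theorem mulVec_inv_col (j : Fin (n + 1)) : X.mat *ᵥ (fun i => (X⁻¹).mat i j) = Pi.single j 1 := by
  have h := X.mat_mul_inv
  ext i
  have := congrFun (congrFun h i) j
  rw [Matrix.mul_apply] at this
  rw [Matrix.mulVec, dotProduct, this, Matrix.one_apply, Pi.single_apply]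

variable {T} {B : A}

theorem den_inv_comp (hB : B * X.den T = 1) : (X⁻¹).den (fun j => B * X.num T j) = B := by
  have h := X.homog_col T (fun i => (X⁻¹).mat i 0)
  rw [X.mulVec_inv_col] at h
  have h2 : ∑ i, (Pi.single 0 1 : Fin (n + 1) → ℂ) i • homog T i = 1 := by
    simp [Pi.single_apply, homog]
  rw [h2] at h
  calc (X⁻¹).den (fun j => B * X.num T j)
      = B * ((X⁻¹).mat 0 0 • X.den T - ∑ k : Fin n, (X⁻¹).mat k.succ 0 • X.num T k) := by
        rw [mul_sub, mul_smul_comm, hB, Finset.mul_sum]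
        simp only [den, x, z, mul_smul_comm]
    _ = B := by rw [h, mul_one]

theorem num_inv_comp (hB : B * X.den T = 1) (j : Fin n) : (X⁻¹).num (fun j => B * X.num T j) j = B * T j := by
  have h := X.homog_col T (fun i => (X⁻¹).mat i j.succ)
  rw [X.mulVec_inv_col] at h
  have h2 : ∑ i, (Pi.single j.succ 1 : Fin (n + 1) → ℂ) i • homog T i = - T j := by
    simp [Pi.single_apply, homog]
  rw [h2] at h
  calc (X⁻¹).num (fun j => B * X.num T j) j
      = -(B * ((X⁻¹).mat 0 j.succ • X.den T -
          ∑ k : Fin n, (X⁻¹).mat k.succ j.succ • X.num T k)) := by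
        rw [mul_sub, mul_smul_comm, hB, Finset.mul_sum]
        simp only [num, X', y, mul_smul_comm, Matrix.of_apply]
        abel
    _ = B * T j := by rw [h, mul_neg, neg_neg]

end Moebius

section Hilbert
variable {H : Type*} [NormedAddCommGroup H] [InnerProductSpace ℂ H]
  {T : Fin n → H →L[ℂ] H}

/-- If `(x - T[z]) η = e + ∑ (T[X' e_j] - y_j) u_j` then the components `(q_0, q)` of `X (η, u)`
satisfy `q_0 = e + ∑ T_k q_k`. -/
theorem apply_eq {η : H} {u : Fin n → H} {e : H} (h : X.den T η = e + ∑ j, X.num T j (u j)) :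
    ∑ j, X.mat 0 j • (Fin.cons η u : Fin (n + 1) → H) j =
      e + ∑ k : Fin n, T k (∑ j, X.mat k.succ j • (Fin.cons η u : Fin (n + 1) → H) j) := by
  have h1 : X.den T η = X.x • η - ∑ k, X.z k • T k η := by
    simp [den]
  have h2 : ∀ j, X.num T j (u j) = ∑ k, X.X' k j • T k (u j) - X.y j • u j := fun j => by
    simp [num]
  rw [h1] at h
  simp only [h2, Finset.sum_sub_distrib] at h
  simp only [Fin.sum_univ_succ, Fin.cons_zero, Fin.cons_succ, map_add, map_sum, map_smul,
    Finset.sum_add_distrib]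
  rw [Finset.sum_comm] at h
  have h3 : X.x • η = e + (∑ k, ∑ j, X.X' k j • T k (u j) - ∑ j, X.y j • u j) +
    ∑ k, X.z k • T k η := by rw [← h]; abel
  change X.x • η + ∑ j, X.y j • u j = e + (∑ k, X.z k • T k η + ∑ k, ∑ j, X.X' k j • T k (u j))
  rw [h3]
  abel

end Hilbert

end U1

theorem L_eq_creation (i : Fin n) : L i = (creation i : FockTensor n ℂ →L[ℂ] FockTensor n ℂ) := by
  refine clm_ext fun w x => ?_
  have hx : (lp.single 2 w x : Fock n) = x • basisVec w := by
    rw [basisVec, ← lp.single_smul]; simp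
  rw [hx, map_smul, map_smul, L_basisVec, basisVec, basisVec, creation_single]

theorem inner_L_L (i j : Fin n) (ξ η : Fock n) :
    ⟪L i ξ, L j η⟫_ℂ = if i = j then ⟪ξ, η⟫_ℂ else 0 := by
  rw [← ContinuousLinearMap.adjoint_inner_right]
  have : adjoint (L i) (L j η) = if i = j then η else 0 := by
    refine lp.ext (funext fun w => ?_)
    rw [L_eq_creation, L_eq_creation, RowContraction.adjoint_creation_apply, creation_apply_cons]
    split_ifs <;> rfl
  rw [this]
  split_ifs <;> simp

theorem inner_one_L (i : Fin n) (ξ : Fock n) : ⟪(basisVec 1 : Fock n), L i ξ⟫_ℂ = 0 := by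
  rw [basisVec, lp.inner_single_left, L_eq_creation, creation_apply_one]; simp

theorem inner_sum_L (u v : Fin n → Fock n) :
    ⟪∑ i, L i (u i), ∑ i, L i (v i)⟫_ℂ = ∑ i, ⟪u i, v i⟫_ℂ := by
  rw [sum_inner]
  refine Finset.sum_congr rfl fun i _ => ?_
  rw [inner_sum]
  simp [inner_L_L]

theorem norm_sum_L_sq (u : Fin n → Fock n) : ‖∑ i, L i (u i)‖ ^ 2 = ∑ i, ‖u i‖ ^ 2 := by
  have h := inner_sum_L u u
  simp only [inner_self_eq_norm_sq_to_K] at h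
  exact_mod_cast h

/-- The generator `L_i` as an element of the norm closed algebra. -/
noncomputable def Lₙ (i : Fin n) : normAlg n := ⟨L i, L_mem_normAlg i⟩

instance : CompleteSpace (normAlg n) :=
  (Subalgebra.isClosed_topologicalClosure _).completeSpace_coe

theorem coe_den (X : U1 n) : ((X.den Lₙ : normAlg n) : Fock n →L[ℂ] Fock n) = X.den L := by
  simp [U1.den, Lₙ]

theorem coe_num (X : U1 n) (j : Fin n) :
    ((X.num Lₙ j : normAlg n) : Fock n →L[ℂ] Fock n) = X.num L j := by
  simp [U1.num, Lₙ]

theorem isUnit_den (X : U1 n) : IsUnit (X.den (Lₙ (n := n))) := by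
  have hx : X.x ≠ 0 := by
    intro h
    have := X.norm_x_sq
    rw [h] at this
    have h2 := Finset.sum_nonneg (s := Finset.univ) fun i _ => sq_nonneg ‖X.z i‖
    simp at this
    linarith
  have hx0 : 0 < ‖X.x‖ := norm_pos_iff.2 hx
  set t : normAlg n := X.x⁻¹ • ∑ i, X.z i • Lₙ i with ht
  have hlt : ∑ i, ‖X.z i‖ ^ 2 < ‖X.x‖ ^ 2 := by rw [X.norm_x_sq]; linarith
  have hnorm : ‖(t : Fock n →L[ℂ] Fock n)‖ < 1 := by
    have hs : ‖∑ i, X.z i • L i‖ ≤ Real.sqrt (∑ i, ‖X.z i‖ ^ 2) := by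
      refine ContinuousLinearMap.opNorm_le_bound _ (Real.sqrt_nonneg _) fun ξ => ?_
      refine (sq_le_sq₀ (norm_nonneg _) (by positivity)).1 ?_
      rw [mul_pow, Real.sq_sqrt (Finset.sum_nonneg fun i _ => sq_nonneg _)]
      have : (∑ i, X.z i • L i) ξ = ∑ i, L i (X.z i • ξ) := by simp
      rw [this, norm_sum_L_sq, Finset.sum_mul]
      simp [norm_smul, mul_pow]
    have h1 : (t : Fock n →L[ℂ] Fock n) = X.x⁻¹ • ∑ i, X.z i • L i := by
      simp [ht, Lₙ]
    rw [h1, norm_smul, norm_inv]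
    have h2 : Real.sqrt (∑ i, ‖X.z i‖ ^ 2) < ‖X.x‖ := by
      rw [Real.sqrt_lt' hx0]; exact hlt
    rw [inv_mul_lt_iff₀ hx0, mul_one]
    exact hs.trans_lt h2
  have h1 : IsUnit (1 - t) := isUnit_one_sub_of_norm_lt_one hnorm
  have h2 : X.den Lₙ = (X.x • (1 : normAlg n)) * (1 - t) := by
    rw [ht, smul_mul_assoc, one_mul, smul_sub, smul_smul, mul_inv_cancel₀ hx, one_smul, U1.den]
  rw [h2]
  refine IsUnit.mul ?_ h1
  have := (Units.mk0 X.x hx).isUnit.map (algebraMap ℂ (normAlg n))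
  rwa [Units.val_mk0, Algebra.algebraMap_eq_smul_one] at this

/-- the inverse of `x - L[z]` -/
noncomputable def resN (X : U1 n) : normAlg n := Ring.inverse (X.den Lₙ)

theorem resN_mul (X : U1 n) : resN X * X.den Lₙ = 1 := Ring.inverse_mul_cancel _ (isUnit_den X)
theorem mul_resN (X : U1 n) : X.den Lₙ * resN X = 1 := Ring.mul_inverse_cancel _ (isUnit_den X)

/-- The inverse of `x - L[z]`, as an operator. -/
noncomputable def res (X : U1 n) : Fock n →L[ℂ] Fock n := (resN X : Fock n →L[ℂ] Fock n)

theorem res_mul (X : U1 n) : res X * X.den L = 1 := by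
  have := congrArg (fun a : normAlg n => (a : Fock n →L[ℂ] Fock n)) (resN_mul X)
  simpa [coe_den, res] using this

theorem mul_res (X : U1 n) : X.den L * res X = 1 := by
  have := congrArg (fun a : normAlg n => (a : Fock n →L[ℂ] Fock n)) (mul_resN X)
  simpa [coe_den, res] using this

theorem inner_of_den_eq (X : U1 n) {η η' : Fock n} {u u' : Fin n → Fock n} {c c' : ℂ}
    (h : X.den L η = c • basisVec 1 + ∑ j, X.num L j (u j))
    (h' : X.den L η' = c' • basisVec 1 + ∑ j, X.num L j (u' j)) :
    ⟪η, η'⟫_ℂ = ⟪c • (basisVec 1 : Fock n), c' • (basisVec 1 : Fock n)⟫_ℂ + ∑ j, ⟪u j, u' j⟫_ℂ := by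
  have key := X.inner_preserving (Fin.cons η u : Fin (n + 1) → Fock n) (Fin.cons η' u')
  rw [X.apply_eq h, X.apply_eq h'] at key
  simp only [Fin.cons_zero, Fin.cons_succ] at key
  set q : Fin n → Fock n := fun k => ∑ j, X.mat k.succ j • (Fin.cons η u : Fin (n + 1) → Fock n) j
    with hq
  set q' : Fin n → Fock n :=
    fun k => ∑ j, X.mat k.succ j • (Fin.cons η' u' : Fin (n + 1) → Fock n) j with hq'
  have key' : -⟪c • (basisVec 1 : Fock n) + ∑ i, L i (q i), c' • basisVec 1 + ∑ i, L i (q' i)⟫_ℂ +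
      ∑ k, ⟪q k, q' k⟫_ℂ = -⟪η, η'⟫_ℂ + ∑ j, ⟪u j, u' j⟫_ℂ := key
  clear_value q q'
  have h1 : ⟪c • (basisVec 1 : Fock n), ∑ i, L i (q' i)⟫_ℂ = 0 := by
    rw [inner_sum]
    exact Finset.sum_eq_zero fun i _ => by rw [inner_smul_left, inner_one_L, mul_zero]
  have h2 : ⟪∑ i, L i (q i), c' • (basisVec 1 : Fock n)⟫_ℂ = 0 := by
    rw [sum_inner]
    refine Finset.sum_eq_zero fun i _ => ?_
    rw [← inner_conj_symm, inner_smul_left, inner_one_L, mul_zero, map_zero]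
  rw [inner_add_left, inner_add_right, inner_add_right, inner_sum_L, h1, h2] at key'
  linear_combination key'

/-- The operator `(x - L[z])⁻¹ (L[X' e_j] - y_j)`. -/
noncomputable def V (X : U1 n) (j : Fin n) : Fock n →L[ℂ] Fock n := res X * X.num L j

/-- The image `(x - L[z])⁻¹ e_∅` of the vacuum. -/
noncomputable def vac (X : U1 n) : Fock n := res X (basisVec 1)

theorem den_V_apply (X : U1 n) (j : Fin n) (ξ : Fock n) :
    X.den L (V X j ξ) = (0 : ℂ) • basisVec 1 + ∑ k, X.num L k ((Pi.single j ξ : Fin n → Fock n) k) := by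
  have h := congrArg (fun A => A (X.num L j ξ)) (mul_res X)
  rw [zero_smul, zero_add, Finset.sum_eq_single j (fun k _ hk => by simp [Pi.single_eq_of_ne hk])
    (by simp), Pi.single_eq_same]
  exact h

theorem den_vac (X : U1 n) :
    X.den L (vac X) = (1 : ℂ) • basisVec 1 + ∑ k, X.num L k ((0 : Fin n → Fock n) k) := by
  have h := congrArg (fun A => A (basisVec 1)) (mul_res X)
  simp only [Pi.zero_apply, map_zero, Finset.sum_const_zero, add_zero, one_smul]
  exact h

theorem inner_V_V (X : U1 n) (i j : Fin n) (ξ η : Fock n) :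
    ⟪V X i ξ, V X j η⟫_ℂ = if i = j then ⟪ξ, η⟫_ℂ else 0 := by
  rw [inner_of_den_eq X (den_V_apply X i ξ) (den_V_apply X j η), zero_smul, inner_zero_left,
    zero_add]
  by_cases hij : i = j
  · subst hij
    rw [if_pos rfl, Finset.sum_eq_single i (fun k _ hk => by simp [Pi.single_eq_of_ne hk]) (by simp)]
    simp
  · rw [if_neg hij]
    refine Finset.sum_eq_zero fun k _ => ?_
    by_cases hk : k = i
    · subst hk; rw [Pi.single_eq_of_ne hij, inner_zero_right]
    · rw [Pi.single_eq_of_ne hk, inner_zero_left]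

theorem inner_V_vac (X : U1 n) (i : Fin n) (ξ : Fock n) : ⟪V X i ξ, vac X⟫_ℂ = 0 := by
  rw [inner_of_den_eq X (den_V_apply X i ξ) (den_vac X), zero_smul]
  simp

theorem inner_vac_vac (X : U1 n) : ⟪vac X, vac X⟫_ℂ = 1 := by
  rw [inner_of_den_eq X (den_vac X) (den_vac X), one_smul, inner_basisVec]
  simp

theorem orthonormal_V (X : U1 n) : Orthonormal ℂ fun w : Word n => FreeMonoid.lift (V X) w (vac X) := by
  rw [orthonormal_iff_ite]
  intro v
  induction v using FreeMonoid.inductionOn' with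
  | one =>
    intro w
    cases w using FreeMonoid.casesOn with
    | one =>
      rw [if_pos rfl, map_one]
      exact inner_vac_vac X
    | of_mul j w =>
      have : (1 : Word n) ≠ FreeMonoid.of j * w := fun h => List.cons_ne_nil _ _ h.symm
      rw [if_neg this, map_mul, FreeMonoid.lift_eval_of, map_one, ← inner_conj_symm]
      simp [inner_V_vac]
  | of_mul i v ih =>
    intro w
    cases w using FreeMonoid.casesOn with
    | one =>
      have : FreeMonoid.of i * v ≠ (1 : Word n) := fun h => List.cons_ne_nil _ _ h
      rw [if_neg this, map_mul, FreeMonoid.lift_eval_of, map_one]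
      simp [inner_V_vac]
    | of_mul j w =>
      rw [map_mul, map_mul, FreeMonoid.lift_eval_of, FreeMonoid.lift_eval_of]
      simp only [mul_apply_eq_comp, inner_V_V, ih w]
      have key : (FreeMonoid.of i * v = FreeMonoid.of j * w) ↔ (i = j ∧ v = w) := by
        constructor
        · intro h; exact List.cons_eq_cons.1 h
        · rintro ⟨rfl, rfl⟩; rfl
      simp only [key, ite_and]

/-- The isometry that maps `e_w` to `V_w (x - L[z])⁻¹ e_∅`. -/
noncomputable def isoU (X : U1 n) : Fock n →ₗᵢ[ℂ] Fock n :=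
  (orthonormal_V X).orthogonalFamily.linearIsometry

theorem isoU_basisVec (X : U1 n) (w : Word n) :
    isoU X (basisVec w) = FreeMonoid.lift (V X) w (vac X) := by
  simp [isoU, basisVec]

theorem fock_ext {A B : Fock n →L[ℂ] Fock n} (h : ∀ w, A (basisVec w) = B (basisVec w)) : A = B := by
  refine clm_ext fun w x => ?_
  have hx : (lp.single 2 w x : Fock n) = x • basisVec w := by
    rw [basisVec, ← lp.single_smul]; simp
  rw [hx, map_smul, map_smul, h]

theorem isoU_L (X : U1 n) (j : Fin n) (ξ : Fock n) : isoU X (L j ξ) = V X j (isoU X ξ) := by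
  have : (isoU X).toContinuousLinearMap ∘L L j = V X j ∘L (isoU X).toContinuousLinearMap := by
    refine fock_ext fun w => ?_
    change isoU X (L j (basisVec w)) = V X j (isoU X (basisVec w))
    rw [L_basisVec, isoU_basisVec, isoU_basisVec, map_mul, FreeMonoid.lift_eval_of]
    rfl
  exact congrArg (fun A => A ξ) this

theorem isoU_den (X Y : U1 n) (ξ : Fock n) : isoU X (Y.den L ξ) = Y.den (V X) (isoU X ξ) := by
  simp [U1.den, isoU_L]

theorem isoU_num (X Y : U1 n) (j : Fin n) (ξ : Fock n) :
    isoU X (Y.num L j ξ) = Y.num (V X) j (isoU X ξ) := by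
  simp [U1.num, isoU_L]

theorem isoU_res_inv (X : U1 n) (ξ : Fock n) :
    isoU X (res X⁻¹ ξ) = X.den L (isoU X ξ) := by
  have h1 : X⁻¹.den L (res X⁻¹ ξ) = ξ := congrArg (fun A => A ξ) (mul_res X⁻¹)
  have h2 := isoU_den X X⁻¹ (res X⁻¹ ξ)
  rw [h1] at h2
  have h3 : X⁻¹.den (V X) = res X := X.den_inv_comp (res_mul X)
  rw [h2, h3]
  exact (congrArg (fun A => A (isoU X (res X⁻¹ ξ))) (mul_res X)).symm

theorem isoU_vac_inv (X : U1 n) : isoU X (vac X⁻¹) = basisVec 1 := by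
  rw [vac, isoU_res_inv]
  have : isoU X (basisVec 1) = vac X := by rw [isoU_basisVec, map_one]; rfl
  rw [this, vac]
  exact congrArg (fun A => A (basisVec 1)) (mul_res X)

theorem isoU_V_inv (X : U1 n) (j : Fin n) (ξ : Fock n) :
    isoU X (V X⁻¹ j ξ) = L j (isoU X ξ) := by
  change isoU X (res X⁻¹ (X⁻¹.num L j ξ)) = _
  rw [isoU_res_inv, isoU_num]
  have h : X⁻¹.num (V X) j = res X * L j := X.num_inv_comp (res_mul X) j
  rw [h]
  exact congrArg (fun A => A (L j (isoU X ξ))) (mul_res X)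

theorem isoU_isoU_inv (X : U1 n) (ξ : Fock n) : isoU X (isoU X⁻¹ ξ) = ξ := by
  have : (isoU X).toContinuousLinearMap ∘L (isoU X⁻¹).toContinuousLinearMap =
      ContinuousLinearMap.id ℂ (Fock n) := by
    refine fock_ext fun w => ?_
    change isoU X (isoU X⁻¹ (basisVec w)) = basisVec w
    rw [isoU_basisVec]
    induction w using FreeMonoid.inductionOn' with
    | one => rw [map_one]; exact isoU_vac_inv X
    | of_mul i w ih =>
      rw [map_mul, FreeMonoid.lift_eval_of, mul_apply_eq_comp, isoU_V_inv, ih,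
        L_basisVec]
  exact congrArg (fun A => A ξ) this

/-- The isometry above is onto. -/
noncomputable def unitU (X : U1 n) : Fock n ≃ₗᵢ[ℂ] Fock n :=
  LinearIsometryEquiv.ofSurjective (isoU X) fun ξ => ⟨isoU X⁻¹ ξ, isoU_isoU_inv X ξ⟩

theorem unitU_apply (X : U1 n) (ξ : Fock n) : unitU X ξ = isoU X ξ := rfl

theorem unitU_symm_apply (X : U1 n) (ξ : Fock n) : (unitU X).symm ξ = isoU X⁻¹ ξ := by
  rw [LinearIsometryEquiv.symm_apply_eq, unitU_apply, isoU_isoU_inv]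

/-- The conjugation `A ↦ U A U*`. -/
noncomputable def conj (U : Fock n ≃ₗᵢ[ℂ] Fock n) :
    (Fock n →L[ℂ] Fock n) →ₐ[ℂ] (Fock n →L[ℂ] Fock n) :=
  AlgHom.ofLinearMap
    { toFun := fun A => U.toLinearIsometry.toContinuousLinearMap ∘L A ∘L
        U.symm.toLinearIsometry.toContinuousLinearMap
      map_add' := fun A B => by ext ξ : 1; simp
      map_smul' := fun c A => by ext ξ : 1; simp }
    (by ext ξ : 1; simp) (fun A B => by ext ξ : 1; simp)

theorem conj_apply (U : Fock n ≃ₗᵢ[ℂ] Fock n) (A : Fock n →L[ℂ] Fock n) (ξ : Fock n) :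
    conj U A ξ = U (A (U.symm ξ)) := rfl

/-- The identity, into the space of operators with the weak operator topology. -/
noncomputable def toWOT : (Fock n →L[ℂ] Fock n) →ₐ[ℂ] (Fock n →WOT[ℂ] Fock n) :=
  (ContinuousLinearMapWOT.algEquiv ℂ).symm.toAlgHom

variable (n) in
/-- The algebra `𝔏_n`: the closure, in the weak operator topology, of the unital algebra generated by
`L_1, …, L_n`. -/
noncomputable def weakAlg : Subalgebra ℂ (Fock n →L[ℂ] Fock n) :=
  ((Algebra.adjoin ℂ (Set.range L)).map toWOT).topologicalClosure.comap toWOT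

theorem mem_weakAlg_iff {A : Fock n →L[ℂ] Fock n} : A ∈ weakAlg n ↔
    ContinuousLinearMapWOT.ofCLM A ∈ closure (ContinuousLinearMapWOT.ofCLM ''
      ((Algebra.adjoin ℂ (Set.range L) : Subalgebra ℂ (Fock n →L[ℂ] Fock n)) :
        Set (Fock n →L[ℂ] Fock n))) := Iff.rfl

theorem normAlg_le_weakAlg : normAlg n ≤ weakAlg n := by
  intro A hA
  rw [mem_weakAlg_iff]
  exact image_closure_subset_closure_image ContinuousLinearMapWOT.continuous_ofCLM ⟨A, hA, rfl⟩

theorem L_mem_weakAlg (i : Fin n) : L i ∈ weakAlg n := normAlg_le_weakAlg (L_mem_normAlg i)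

theorem V_mem_normAlg (X : U1 n) (j : Fin n) : V X j ∈ normAlg n := by
  have : V X j = ((resN X * X.num Lₙ j : normAlg n) : Fock n →L[ℂ] Fock n) := by
    rw [MulMemClass.coe_mul, coe_num]; rfl
  rw [this]
  exact Subtype.prop _

theorem conj_L (X : U1 n) (j : Fin n) : conj (unitU X) (L j) = V X j := by
  ext ξ : 1
  rw [conj_apply, unitU_apply, isoU_L, ← unitU_apply, LinearIsometryEquiv.apply_symm_apply]

theorem conj_mem (X : U1 n) {A : Fock n →L[ℂ] Fock n} (hA : A ∈ weakAlg n) :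
    conj (unitU X) A ∈ weakAlg n := by
  have hadj : Algebra.adjoin ℂ (Set.range L) ≤ (weakAlg n).comap (conj (unitU X)) := by
    refine Algebra.adjoin_le ?_
    rintro _ ⟨i, rfl⟩
    change conj (unitU X) (L i) ∈ weakAlg n
    rw [conj_L]
    exact normAlg_le_weakAlg (V_mem_normAlg X i)
  let f : (Fock n →WOT[ℂ] Fock n) → (Fock n →WOT[ℂ] Fock n) := fun B =>
    (ContinuousLinearMapWOT.ofCLM (unitU X).toLinearIsometry.toContinuousLinearMap).comp
      (B.comp (ContinuousLinearMapWOT.ofCLM (unitU X).symm.toLinearIsometry.toContinuousLinearMap))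
  have hf : Continuous f := by fun_prop
  rw [mem_weakAlg_iff] at hA ⊢
  have h1 := image_closure_subset_closure_image hf ⟨_, hA, rfl⟩
  have h2 := closure_mono (t := closure (ContinuousLinearMapWOT.ofCLM ''
      ((Algebra.adjoin ℂ (Set.range L) : Subalgebra ℂ (Fock n →L[ℂ] Fock n)) :
        Set (Fock n →L[ℂ] Fock n)))) (by
    rintro _ ⟨_, ⟨B, hB, rfl⟩, rfl⟩
    exact mem_weakAlg_iff.1 (hadj hB)) h1
  rw [closure_closure] at h2
  exact h2

theorem conj_unitU_inv (X : U1 n) (A : Fock n →L[ℂ] Fock n) :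
    conj (unitU X) (conj (unitU X⁻¹) A) = A := by
  ext ξ : 1
  rw [conj_apply, conj_apply, unitU_apply, unitU_apply, isoU_isoU_inv, unitU_symm_apply,
    unitU_symm_apply, inv_inv, isoU_isoU_inv]

/-- The restriction to `𝔏_n` of the conjugation by `U_X`. -/
noncomputable def autΦ (X : U1 n) : weakAlg n ≃ₐ[ℂ] weakAlg n :=
  AlgEquiv.ofAlgHom
    (((conj (unitU X)).comp (weakAlg n).val).codRestrict (weakAlg n) fun A => conj_mem X A.2)
    (((conj (unitU X⁻¹)).comp (weakAlg n).val).codRestrict (weakAlg n) fun A => conj_mem X⁻¹ A.2)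
    (by
      ext A : 2
      exact conj_unitU_inv X A)
    (by
      ext A : 2
      have := conj_unitU_inv X⁻¹ A
      rw [inv_inv] at this
      exact this)

theorem coe_autΦ (X : U1 n) (A : weakAlg n) :
    (autΦ X A : Fock n →L[ℂ] Fock n) = conj (unitU X) A := rfl

theorem coe_autΦ_symm (X : U1 n) (A : weakAlg n) :
    ((autΦ X).symm A : Fock n →L[ℂ] Fock n) = conj (unitU X⁻¹) A := rfl

/-- The element `L[ζ] = ∑ ζ_i L_i` of `𝔏_n`. -/
noncomputable def Llin (ζ : Fin n → ℂ) : weakAlg n := ∑ i, ζ i • ⟨L i, L_mem_weakAlg i⟩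

theorem coe_Llin (ζ : Fin n → ℂ) : (Llin ζ : Fock n →L[ℂ] Fock n) = ∑ i, ζ i • L i := by
  simp [Llin]

/-- `x I - L[z]` is invertible, so `Ring.inverse` below is a genuine inverse. -/
theorem isUnit_sub_Llin (X : U1 n) : IsUnit (X.x • (1 : weakAlg n) - Llin X.z) := by
  have h : ((X.x • (1 : weakAlg n) - Llin X.z : weakAlg n) : Fock n →L[ℂ] Fock n) = X.den L := by
    rw [U1.den, ← coe_Llin]; rfl
  have hr : res X ∈ weakAlg n := normAlg_le_weakAlg (resN X).2
  refine ⟨⟨_, ⟨res X, hr⟩, Subtype.ext ?_, Subtype.ext ?_⟩, rfl⟩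
  · rw [MulMemClass.coe_mul, h]; exact mul_res X
  · rw [MulMemClass.coe_mul, h]; exact res_mul X

/-- The inverse `(x I - L[z])⁻¹` in `𝔏_n`. -/
noncomputable def resW (X : U1 n) : weakAlg n := Ring.inverse (X.x • (1 : weakAlg n) - Llin X.z)

theorem coe_resW (X : U1 n) : (resW X : Fock n →L[ℂ] Fock n) = res X := by
  have h : ((X.x • (1 : weakAlg n) - Llin X.z : weakAlg n) : Fock n →L[ℂ] Fock n) = X.den L := by
    rw [U1.den, ← coe_Llin]; rfl
  have h1 := congrArg (fun A : weakAlg n => (A : Fock n →L[ℂ] Fock n) * res X)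
    (Ring.inverse_mul_cancel _ (isUnit_sub_Llin X))
  simp only [MulMemClass.coe_mul, h, mul_assoc, mul_res, mul_one] at h1
  rw [resW, h1]
  exact one_mul _

/-- The Voiculescu automorphism `Φ` of `𝔏_n` given by `X`, and the unitary `U` that implements it:
`Φ(L[ζ]) = (x I - L[z])⁻¹ (L[X' ζ] - (ζ · y) I)`, `U (A e_∅) = Φ(A) (x I - L[z])⁻¹ e_∅`, and
`Φ(A) = U A U*`. There is exactly one such pair, see `existsUnique_voiculescu`. -/
structure IsVoiculescuPair (X : U1 n) (Φ : weakAlg n ≃ₐ[ℂ] weakAlg n)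
    (U : Fock n ≃ₗᵢ[ℂ] Fock n) : Prop where
  map_Llin : ∀ ζ : Fin n → ℂ,
    Φ (Llin ζ) = resW X * (Llin (X.X' *ᵥ ζ) - (ζ ⬝ᵥ X.y) • (1 : weakAlg n))
  apply_vacuum : ∀ A : weakAlg n,
    U ((A : Fock n →L[ℂ] Fock n) (basisVec 1)) =
      (Φ A : Fock n →L[ℂ] Fock n) ((resW X : Fock n →L[ℂ] Fock n) (basisVec 1))
  implements : ∀ (A : weakAlg n) (ξ : Fock n),
    (Φ A : Fock n →L[ℂ] Fock n) ξ = U ((A : Fock n →L[ℂ] Fock n) (U.symm ξ))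

theorem num_sum (X : U1 n) (ζ : Fin n → ℂ) :
    ∑ j, ζ j • X.num L j =
      ((Llin (X.X' *ᵥ ζ) - (ζ ⬝ᵥ X.y) • (1 : weakAlg n) : weakAlg n) : Fock n →L[ℂ] Fock n) := by
  have : ((Llin (X.X' *ᵥ ζ) - (ζ ⬝ᵥ X.y) • (1 : weakAlg n) : weakAlg n) : Fock n →L[ℂ] Fock n) =
      ∑ i, (X.X' *ᵥ ζ) i • L i - (ζ ⬝ᵥ X.y) • 1 := by
    rw [← coe_Llin]; rfl
  rw [this]
  simp only [U1.num, smul_sub, Finset.sum_sub_distrib, Finset.smul_sum, smul_smul, Matrix.mulVec,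
    dotProduct, Finset.sum_smul]
  rw [Finset.sum_comm]
  simp only [mul_comm]

theorem isVoiculescuPair (X : U1 n) : IsVoiculescuPair X (autΦ X) (unitU X) where
  map_Llin ζ := by
    refine Subtype.ext ?_
    rw [coe_autΦ, coe_Llin, map_sum, MulMemClass.coe_mul, coe_resW, ← num_sum, Finset.mul_sum]
    refine Finset.sum_congr rfl fun j _ => ?_
    rw [map_smul, conj_L, V, mul_smul_comm]
  apply_vacuum A := by
    have h : (resW X : Fock n →L[ℂ] Fock n) (basisVec 1) = unitU X (basisVec 1) := by
      rw [coe_resW, unitU_apply, isoU_basisVec, map_one]; rfl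
    rw [h, coe_autΦ, conj_apply, LinearIsometryEquiv.symm_apply_apply]
  implements A ξ := rfl

theorem IsVoiculescuPair.eq {X : U1 n} {Φ : weakAlg n ≃ₐ[ℂ] weakAlg n}
    {U : Fock n ≃ₗᵢ[ℂ] Fock n} (h : IsVoiculescuPair X Φ U) : Φ = autΦ X ∧ U = unitU X := by
  have h0 := isVoiculescuPair X
  let Lw : Fin n → weakAlg n := fun i => ⟨L i, L_mem_weakAlg i⟩
  have hL : ∀ i, Φ (Lw i) = autΦ X (Lw i) := fun i => by
    have : Lw i = Llin (Pi.single i 1) := by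
      simp [Llin, Lw, Pi.single_apply]
    rw [this, h.map_Llin, h0.map_Llin]
  have hw : ∀ w : Word n, Φ (FreeMonoid.lift Lw w) = autΦ X (FreeMonoid.lift Lw w) := fun w => by
    induction w using FreeMonoid.inductionOn' with
    | one => simp
    | of_mul i w ih => simp only [map_mul, FreeMonoid.lift_eval_of, hL, ih]
  have hb : ∀ w : Word n, ((FreeMonoid.lift Lw w : weakAlg n) : Fock n →L[ℂ] Fock n) (basisVec 1) =
      basisVec w := fun w => by
    induction w using FreeMonoid.inductionOn' with
    | one => simp
    | of_mul i w ih =>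
      rw [map_mul, FreeMonoid.lift_eval_of, MulMemClass.coe_mul, mul_apply_eq_comp, ih]
      exact L_basisVec i w
  have hU : U = unitU X := by
    have : U.toLinearIsometry.toContinuousLinearMap =
        (unitU X).toLinearIsometry.toContinuousLinearMap := by
      refine fock_ext fun w => ?_
      change U (basisVec w) = unitU X (basisVec w)
      rw [← hb, h.apply_vacuum, h0.apply_vacuum, hw]
    exact LinearIsometryEquiv.ext fun ξ => congrArg (fun A => A ξ) this
  refine ⟨AlgEquiv.ext fun A => Subtype.ext (ContinuousLinearMap.ext fun ξ => ?_), hU⟩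
  rw [h.implements, h0.implements, hU]

theorem existsUnique_voiculescu (X : U1 n) :
    ∃! p : (weakAlg n ≃ₐ[ℂ] weakAlg n) × (Fock n ≃ₗᵢ[ℂ] Fock n), IsVoiculescuPair X p.1 p.2 :=
  ⟨(autΦ X, unitU X), isVoiculescuPair X, fun _ hp => Prod.ext hp.eq.1 hp.eq.2⟩

/-- The Voiculescu automorphism `Φ_X` of `𝔏_n`. -/
noncomputable def voiculescuAut (X : U1 n) : weakAlg n ≃ₐ[ℂ] weakAlg n :=
  (existsUnique_voiculescu X).choose.1

/-- The unitary `U_X` that implements `Φ_X`. -/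
noncomputable def voiculescuUnitary (X : U1 n) : Fock n ≃ₗᵢ[ℂ] Fock n :=
  (existsUnique_voiculescu X).choose.2

theorem voiculescu_spec (X : U1 n) : IsVoiculescuPair X (voiculescuAut X) (voiculescuUnitary X) :=
  (existsUnique_voiculescu X).choose_spec.1

theorem voiculescuAut_symm_L (X : U1 n) (i : Fin n) :
    ((voiculescuAut X).symm ⟨L i, L_mem_weakAlg i⟩ : Fock n →L[ℂ] Fock n) = V X⁻¹ i := by
  rw [(voiculescu_spec X).eq.1, coe_autΦ_symm, conj_L]

theorem voiculescuAut_symm_mem (X : U1 n) (i : Fin n) :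
    ((voiculescuAut X).symm ⟨L i, L_mem_weakAlg i⟩ : Fock n →L[ℂ] Fock n) ∈ normAlg n := by
  rw [voiculescuAut_symm_L]
  exact V_mem_normAlg _ _

namespace RowContraction

variable {H : Type*} [NormedAddCommGroup H] [InnerProductSpace ℂ H] [CompleteSpace H]
  (T : RowContraction n H)

theorem functionalCalculus_spec : T.IsFunctionalCalculus T.functionalCalculus :=
  T.existsUnique_functionalCalculus.choose_spec.1

theorem sum_invOp_le (X : U1 n) (W : Fin n → H →L[ℂ] H)
    (hW : ∀ j, W j = T.functionalCalculus ⟨V X j, V_mem_normAlg X j⟩) :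
    ∑ i, W i ∘L adjoint (W i) ≤ 1 := by
  rw [sum_le_one_iff]
  intro u
  rw [rowOp_apply]
  have hL : ∀ i, T.functionalCalculus (Lₙ i) = T.op i := T.functionalCalculus_spec.map_L
  have hden : T.functionalCalculus (X.den Lₙ) = X.den T.op := by simp [U1.den, hL]
  have hnum : ∀ j, T.functionalCalculus (X.num Lₙ j) = X.num T.op j := fun j => by
    simp [U1.num, hL]
  have hV : ∀ j, W j = T.functionalCalculus (resN X) * X.num T.op j := fun j => by
    rw [hW, ← hnum, ← map_mul]
    congr 1
    refine Subtype.ext ?_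
    rw [MulMemClass.coe_mul, coe_num]; rfl
  have hmul : X.den T.op * T.functionalCalculus (resN X) = 1 := by
    rw [← hden, ← map_mul, mul_resN, map_one]
  set η := ∑ j, W j (u j) with hη
  have h1 : X.den T.op η = 0 + ∑ j, X.num T.op j (u j) := by
    rw [hη, map_sum, zero_add]
    refine Finset.sum_congr rfl fun j _ => ?_
    rw [hV]
    exact congrArg (fun A => A (X.num T.op j (u j))) hmul
  have h2 := X.apply_eq h1
  have key := X.inner_preserving (Fin.cons η u : Fin (n + 1) → H) (Fin.cons η u)
  rw [h2, zero_add] at key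
  set q : Fin n → H := fun k => ∑ j, X.mat k.succ j • (Fin.cons η u : Fin (n + 1) → H) j
  have h3 : ‖∑ k, T.op k (q k)‖ ^ 2 ≤ ∑ k, ‖q k‖ ^ 2 := by
    have := T.norm_row_le (WithLp.toLp 2 q)
    rw [row, rowOp_apply] at this
    have h4 := (sq_le_sq₀ (norm_nonneg _) (norm_nonneg _)).2 this
    rwa [PiLp.norm_sq_eq_of_L2] at h4
  have key2 : -‖∑ k, T.op k (q k)‖ ^ 2 + ∑ k, ‖q k‖ ^ 2 = -‖η‖ ^ 2 + ∑ j, ‖u j‖ ^ 2 := by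
    have h5 := congrArg Complex.re key
    simp only [inner_self_eq_norm_sq_to_K, Fin.cons_zero, Fin.cons_succ] at h5
    simpa [← Complex.ofReal_pow, inner_self_eq_norm_sq_to_K, q] using h5
  refine (sq_le_sq₀ (norm_nonneg _) (norm_nonneg _)).1 ?_
  rw [PiLp.norm_sq_eq_of_L2]
  linarith

/-- The row contraction `Φ_X⁻¹(T) = (ρ_T(Φ_X⁻¹(L_1)), …, ρ_T(Φ_X⁻¹(L_n)))`; the operators `Φ_X⁻¹(L_i)`
belong to `𝔩_n`, on which `ρ_T` is defined. -/
noncomputable def voiculescuInv (X : U1 n) : RowContraction n H where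
  op i := T.functionalCalculus
    ⟨(voiculescuAut X).symm ⟨L i, L_mem_weakAlg i⟩, voiculescuAut_symm_mem X i⟩
  sum_le := T.sum_invOp_le X⁻¹ _ fun i => by
    congr 1
    exact Subtype.ext (voiculescuAut_symm_L X i)

end RowContraction

end Voiculescu

end RowContr

/-! Put `Y = X⁻¹` and let `S` be the transformed row contraction. The functional calculus gives `S_j
= den(T)⁻¹ num_j(T)`, where `den` and `num_j` are the affine expressions built from the blocks of
`Y`. In homogeneous coordinates this says that `Y` carries the graph of the row operator `S`, the
set of pairs `(S u, u)`, onto the graph of `T`, the set of pairs `(T q, q)`. Everything follows from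
this and from the invariance of the form `-|a_0|² + ∑ |a_i|²`.

On the graph of `S` the form equals `‖D_S u‖²`, and on the graph of `T` it equals `‖D_T q‖²`. Hence
the map `u ↦ q` (`inputMap`) preserves defect norms, and since it is onto it induces the unitary `Z
: D_S u ↦ D_T q`. For the other defect space let `B = den(T)⁻¹`. The group is closed under conjugate
transposition, and `Y*` sends `(B* x, -T_k* B* x)` to `(x, -S_i* x)`. So `‖D_{T*} B* x‖ = ‖D_{S*}
x‖`, which gives `Z_* : D_{S*} x ↦ D_{T*} B* x`.

The Poisson kernel and the characteristic function are then recognized by their covariance and their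
values at the vacuum. `K_T*` is the only bounded operator that intertwines `L_i ⊗ I` with `T_i` and
sends `e_∅ ⊗ k` to `D_{T*} k` (`eq_adjoint_poissonKernel`). `Θ_T` is the only multianalytic operator
with `Θ_T (e_∅ ⊗ D_T u) = ∑_j (L_j ⊗ I) K_T u_j - K_T T u` (`eq_characteristicFunction`). The
unitary `U_X* = U_Y` turns `L_j` into `den(L)⁻¹ num_j(L)` and the vacuum into `den(L)⁻¹ e_∅`, the
same Möbius formula that relates `S` to `T`. After denominators are cleared, both characterizations
of the objects of `S` become linear identities in the entries of `Y`:
`adjoint_poissonKernel_tensorMap` and `tensorMap_characteristicFunction`. -/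

namespace RowContr

/-! ### Unitaries between defect spaces -/

section Extension

variable {E F F' : Type*} [NormedAddCommGroup E] [InnerProductSpace ℂ E] [CompleteSpace E]
  [NormedAddCommGroup F] [InnerProductSpace ℂ F] [CompleteSpace F]
  [NormedAddCommGroup F'] [InnerProductSpace ℂ F'] [CompleteSpace F']

/-- The defect operator, as a map into the defect space. -/
noncomputable def toDefect (C : E →L[ℂ] F) : E →ₗ[ℂ] defectSpace C :=
  (defectOp C).toLinearMap.codRestrict (defectSpace C) (defectOp_mem C)

@[simp] theorem coe_toDefect (C : E →L[ℂ] F) (x : E) : (toDefect C x : E) = defectOp C x := rfl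

theorem denseRange_toDefect (C : E →L[ℂ] F) : DenseRange (toDefect C) := by
  intro x
  rw [closure_subtype]
  have hx : (x : E) ∈ closure (LinearMap.range (defectOp C).toLinearMap : Set E) := x.2
  refine closure_mono ?_ hx
  rintro _ ⟨y, rfl⟩
  exact ⟨toDefect C y, ⟨y, rfl⟩, rfl⟩

/-- A linear surjection that transports the seminorm `‖D_C' ·‖` to `‖D_C ·‖` induces a unitary between
the defect spaces. -/
theorem exists_defect_unitary {E' : Type*} [NormedAddCommGroup E'] [InnerProductSpace ℂ E']
    [CompleteSpace E'] (C : E →L[ℂ] F) (C' : E' →L[ℂ] F') (G : E →ₗ[ℂ] E')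
    (hG : Function.Surjective G) (h : ∀ x, ‖defectOp C' (G x)‖ = ‖defectOp C x‖) :
    ∃ Z : defectSpace C ≃ₗᵢ[ℂ] defectSpace C', ∀ x, Z (toDefect C x) = toDefect C' (G x) := by
  -- Surjectivity of `G` makes the vectors `D_C' (G x)` dense, so the isometric extension is onto.
  -- Both dense families are indexed by `E`, which is why the identity of `E` is the map to be
  -- extended.
  have hd : DenseRange (toDefect C' ∘ₗ G) := by
    rw [LinearMap.coe_comp]
    exact (denseRange_toDefect C').comp hG.denseRange
      ((defectOp C').continuous.subtype_mk _)
  exact ⟨(LinearEquiv.refl ℂ E).extendOfIsometry (toDefect C) (toDefect C' ∘ₗ G)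
      (denseRange_toDefect C) hd h,
    (LinearEquiv.refl ℂ E).extendOfIsometry_eq _ _ (denseRange_toDefect C) hd h⟩

end Extension

/-! ### Tensor products of isometries, and Möbius relations with denominators cleared -/

section TensorMap

variable {n : ℕ} {E E' : Type*}
  [NormedAddCommGroup E] [InnerProductSpace ℂ E] [CompleteSpace E]
  [NormedAddCommGroup E'] [InnerProductSpace ℂ E'] [CompleteSpace E']

theorem tensorMap_tensorMap (U U' : Fock n →ₗᵢ[ℂ] Fock n) (Z : E →ₗᵢ[ℂ] E') (Z' : E' →ₗᵢ[ℂ] E)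
    (hU : ∀ ξ, U (U' ξ) = ξ) (hZ : ∀ x, Z (Z' x) = x) (u : FockTensor n E') :
    tensorMap U Z (tensorMap U' Z' u) = u := by
  have : tensorMap U Z ∘L tensorMap U' Z' = ContinuousLinearMap.id ℂ _ := by
    refine clm_ext fun w x => ?_
    rw [ContinuousLinearMap.comp_apply, tensorMap_single, tensorMap_tmul, hU, hZ, tmul_basisVec]
    rfl
  exact congrArg (fun A => A u) this

theorem norm_tensorMap (U : Fock n →ₗᵢ[ℂ] Fock n) (Z : E →ₗᵢ[ℂ] E') (u : FockTensor n E) :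
    ‖tensorMap U Z u‖ = ‖u‖ :=
  LinearIsometry.norm_map _ u

/-- Applying the isometry `U ⊗ Z` to both entries of the left side removes `U' ⊗ Z'`; thus `U' ⊗ Z'`
is the adjoint of `U ⊗ Z`, and no separate tensor product of adjoints is needed. -/
theorem inner_tensorMap_left (U U' : Fock n →ₗᵢ[ℂ] Fock n) (Z : E →ₗᵢ[ℂ] E') (Z' : E' →ₗᵢ[ℂ] E)
    (hU : ∀ ξ, U (U' ξ) = ξ) (hZ : ∀ x, Z (Z' x) = x) (u : FockTensor n E) (v : FockTensor n E') :
    ⟪tensorMap U' Z' v, u⟫_ℂ = ⟪v, tensorMap U Z u⟫_ℂ := by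
  have h : ∀ a b : FockTensor n E, ⟪tensorMap U Z a, tensorMap U Z b⟫_ℂ = ⟪a, b⟫_ℂ :=
    fun a b => LinearIsometry.inner_map_map _ a b
  rw [← h, tensorMap_tensorMap U U' Z Z' hU hZ]

theorem creation_tmul (i : Fin n) (ξ : Fock n) (x : E) :
    creation i (tmul ξ x) = tmul (L i ξ) x :=
  tensorMap_tmul _ _ _ _

theorem den_creation_tmul (X : U1 n) (ξ : Fock n) (x : E) :
    X.den (creation : Fin n → FockTensor n E →L[ℂ] FockTensor n E) (tmul ξ x) =
      tmul (X.den L ξ) x := by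
  change _ = tmulLeft x (X.den L ξ)
  simp only [U1.den, sub_apply, smul_apply, one_apply_eq_self, sum_apply, map_sub, map_sum, map_smul,
    creation_tmul]
  rfl

theorem num_creation_tmul (X : U1 n) (j : Fin n) (ξ : Fock n) (x : E) :
    X.num (creation : Fin n → FockTensor n E →L[ℂ] FockTensor n E) j (tmul ξ x) =
      tmul (X.num L j ξ) x := by
  change _ = tmulLeft x (X.num L j ξ)
  simp only [U1.num, sub_apply, smul_apply, one_apply_eq_self, sum_apply, map_sub, map_sum, map_smul,
    creation_tmul]
  rfl

/-- This is `U_X L_j = den(L)⁻¹ num_j(L) U_X` tensored with `Z` and multiplied by the denominator.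
In this form it involves only polynomials in the operators `L_i ⊗ I`, and such polynomials commute
with every multianalytic operator up to a change of coefficient space. -/
theorem den_tensorMap_creation (X : U1 n) (Z : E →ₗᵢ[ℂ] E') (j : Fin n) (u : FockTensor n E) :
    X.den (creation : Fin n → FockTensor n E' →L[ℂ] FockTensor n E')
        (tensorMap (isoU X) Z (creation j u)) =
      X.num (creation : Fin n → FockTensor n E' →L[ℂ] FockTensor n E') j
        (tensorMap (isoU X) Z u) := by
  have : X.den creation ∘L tensorMap (isoU X) Z ∘L creation j =
      X.num creation j ∘L tensorMap (isoU X) Z := by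
    refine clm_ext fun w x => ?_
    simp only [ContinuousLinearMap.comp_apply]
    rw [← tmul_basisVec, creation_tmul, tensorMap_tmul, tensorMap_tmul, den_creation_tmul,
      num_creation_tmul, isoU_L]
    congr 1
    exact congrArg (fun A => A (X.num L j (isoU X (basisVec w)))) (mul_res X)
  exact congrArg (fun A => A u) this

/-- The unitary `U_X` exchanges the denominator of `X` with the inverse of the denominator of `X⁻¹`
(`isoU_res_inv`), so the two denominators cancel. -/
theorem den_tensorMap_den (X : U1 n) (Z : E →ₗᵢ[ℂ] E') (u : FockTensor n E) :
    X.den (creation : Fin n → FockTensor n E' →L[ℂ] FockTensor n E')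
        (tensorMap (isoU X) Z (X⁻¹.den (creation : Fin n → FockTensor n E →L[ℂ] FockTensor n E) u)) =
      tensorMap (isoU X) Z u := by
  have : X.den (creation : Fin n → FockTensor n E' →L[ℂ] FockTensor n E') ∘L
      tensorMap (isoU X) Z ∘L X⁻¹.den (creation : Fin n → FockTensor n E →L[ℂ] FockTensor n E) =
        tensorMap (isoU X) Z := by
    refine clm_ext fun w x => ?_
    simp only [ContinuousLinearMap.comp_apply]
    rw [← tmul_basisVec, den_creation_tmul, tensorMap_tmul, tensorMap_tmul, den_creation_tmul,
      ← isoU_res_inv]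
    congr 2
    exact congrArg (fun A => A (basisVec w)) (res_mul X⁻¹)
  exact congrArg (fun A => A u) this

/-- By `den_tensorMap_den` for `X⁻¹`, the vector `den(L ⊗ I) u` determines the image of `u` under an
isometry, hence `u` itself. This permits equations to be checked after multiplication by the
denominator, without an inverse on the tensor product. -/
theorem den_creation_injective (X : U1 n) :
    Function.Injective fun u : FockTensor n E =>
      X.den (creation : Fin n → FockTensor n E →L[ℂ] FockTensor n E) u := by
  intro u v h
  dsimp only at h
  have h' := den_tensorMap_den X⁻¹ (LinearIsometry.id : E →ₗᵢ[ℂ] E) u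
  rw [inv_inv, h] at h'
  have h2 := den_tensorMap_den X⁻¹ (LinearIsometry.id : E →ₗᵢ[ℂ] E) v
  rw [inv_inv] at h2
  rw [h2] at h'
  have h3 : ‖tensorMap (isoU X⁻¹) (LinearIsometry.id : E →ₗᵢ[ℂ] E) (u - v)‖ = 0 := by
    rw [map_sub, h', sub_self, norm_zero]
  rw [norm_tensorMap, norm_eq_zero] at h3
  exact sub_eq_zero.1 h3

end TensorMap

/-! ### Intertwiners pass through numerators and denominators -/

section Intertwining

variable {n : ℕ} {H K : Type*} [NormedAddCommGroup H] [InnerProductSpace ℂ H]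
  [NormedAddCommGroup K] [InnerProductSpace ℂ K]

/-- Denominator and numerators are affine in the operators, so a linear map intertwining the two
families intertwines these as well. It is applied with `K_T*`, from `L_i ⊗ I` to `T_i`, and with
`Θ_T`, from `L_i ⊗ I` to `L_i ⊗ I`. -/
theorem U1.intertwine_den (X : U1 n) {A : Fin n → H →L[ℂ] H} {B : Fin n → K →L[ℂ] K}
    (M : H →L[ℂ] K) (h : ∀ i x, M (A i x) = B i (M x)) (x : H) :
    M (X.den A x) = X.den B (M x) := by
  simp [U1.den, h]

theorem U1.intertwine_num (X : U1 n) {A : Fin n → H →L[ℂ] H} {B : Fin n → K →L[ℂ] K}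
    (M : H →L[ℂ] K) (h : ∀ i x, M (A i x) = B i (M x)) (j : Fin n) (x : H) :
    M (X.num A j x) = X.num B j (M x) := by
  simp [U1.num, h]

end Intertwining

/-! ### Conjugate transposition in `U(1,n)` and the invariant form -/

namespace U1

variable {n : ℕ} (X : U1 n)

theorem sgn_mul_sgn : sgn n * sgn n = 1 := by
  rw [sgn, Matrix.diagonal_mul_diagonal, ← Matrix.diagonal_one]
  congr 1
  funext i
  cases i using Fin.cases <;> simp

/-- The relation `X* J X = J` makes `J X* J` a left inverse of `X`, and a left inverse of a square
matrix is also a right inverse. This yields `X J X* = J` next. -/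
theorem mat_mul_sgn_mul : X.mat * (sgn n * X.mat.conjTranspose * sgn n) = 1 := by
  have hX : X.mat.conjTranspose * sgn n * X.mat = sgn n := X.2
  refine mul_eq_one_comm.1 ?_
  calc sgn n * X.mat.conjTranspose * sgn n * X.mat
      = sgn n * (X.mat.conjTranspose * sgn n * X.mat) := by simp only [Matrix.mul_assoc]
    _ = 1 := by rw [hX, sgn_mul_sgn]

theorem mat_sgn_conjTranspose : X.mat * sgn n * X.mat.conjTranspose = sgn n := by
  calc X.mat * sgn n * X.mat.conjTranspose
      = X.mat * (sgn n * X.mat.conjTranspose * sgn n) * sgn n := by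
        simp only [Matrix.mul_assoc, sgn_mul_sgn, Matrix.mul_one]
    _ = sgn n := by rw [mat_mul_sgn_mul, Matrix.one_mul]

/-- The conjugate transpose of a matrix in `U(1,n)`. -/
def conjT : U1 n :=
  -- Multiplying `X* J X = J` by `J` on the right shows that `X*` has the inverse `J X J`.
  ⟨⟨X.mat.conjTranspose, sgn n * X.mat * sgn n, by
      have hX : X.mat.conjTranspose * sgn n * X.mat = sgn n := X.2
      simpa [sgn_mul_sgn, Matrix.mul_assoc] using congrArg (· * sgn n) hX, by
      simpa [sgn_mul_sgn, Matrix.mul_assoc] using congrArg (sgn n * ·) X.mat_sgn_conjTranspose⟩, by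
    change X.mat.conjTranspose.conjTranspose * sgn n * X.mat.conjTranspose = sgn n
    rw [Matrix.conjTranspose_conjTranspose, mat_sgn_conjTranspose]⟩

theorem conjT_mat (i j : Fin (n + 1)) : X.conjT.mat i j = star (X.mat j i) := rfl

/-- At a point `(C u, u)` of the graph of a row contraction `C` the form is `‖D_C u‖²`. Its
invariance is therefore the source of the equalities between defect norms below. -/
theorem norm_preserving {F : Type*} [NormedAddCommGroup F] [InnerProductSpace ℂ F]
    (a : Fin (n + 1) → F) :
    -‖∑ j, X.mat 0 j • a j‖ ^ 2 + ∑ i : Fin n, ‖∑ j, X.mat i.succ j • a j‖ ^ 2 =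
      -‖a 0‖ ^ 2 + ∑ i : Fin n, ‖a i.succ‖ ^ 2 := by
  have h := X.inner_preserving a a
  simp only [inner_self_eq_norm_sq_to_K] at h
  exact_mod_cast h

end U1

theorem fockTensor_sum_apply {n : ℕ} {E ι : Type*} [NormedAddCommGroup E] [InnerProductSpace ℂ E]
    (s : Finset ι) (f : ι → FockTensor n E) (w : Word n) : (∑ j ∈ s, f j) w = ∑ j ∈ s, f j w :=
  map_sum (lp.evalCLM ℂ (fun _ : Word n => E) 2 w) f s

namespace RowContraction

variable {n : ℕ} {H : Type*} [NormedAddCommGroup H] [InnerProductSpace ℂ H] [CompleteSpace H]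

/-! ### Poisson kernel and characteristic function determined by covariance and vacuum values -/

section Model

variable (T : RowContraction n H)

theorem adjoint_poissonKernel_single (k : T.defectStar) :
    adjoint T.poissonKernel (lp.single 2 1 k) = T.Dstar k := by
  refine ext_inner_right ℂ fun h => ?_
  rw [ContinuousLinearMap.adjoint_inner_left, lp.inner_single_left, Submodule.coe_inner,
    poissonKernel_apply, defectOp_symm]
  simp only [word, map_one, ← ContinuousLinearMap.star_eq_adjoint, star_one]
  rfl

/-- The adjoint of the Poisson kernel is determined by its covariance and its values on the vacuum. -/
theorem eq_adjoint_poissonKernel {P : FockTensor n T.defectStar →L[ℂ] H}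
    (hP : ∀ i u, P (creation i u) = T.op i (P u))
    (h1 : ∀ k : T.defectStar, P (lp.single 2 1 k) = T.Dstar k) : P = adjoint T.poissonKernel := by
  refine clm_ext fun w x => ?_
  induction w using FreeMonoid.inductionOn' with
  | one => rw [h1, adjoint_poissonKernel_single]
  | of_mul i w ih => rw [← creation_single, hP, adjoint_poissonKernel_creation, ih]

theorem adjoint_word_of_mul (i : Fin n) (v : Word n) (h : H) :
    adjoint (T.word (FreeMonoid.of i * v)) h = adjoint (T.word v) (adjoint (T.op i) h) := by
  simp only [word, map_mul, FreeMonoid.lift_eval_of]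
  rw [ContinuousLinearMap.mul_def, ContinuousLinearMap.adjoint_comp]
  rfl

/-- Taking adjoints reverses products. The lemma reconciles the coefficients of `Θ_T`, written as
products of adjoints, with the Poisson kernel, written with the adjoint of a product. -/
theorem lift_adjoint_reverse (v : Word n) :
    FreeMonoid.lift (fun i => adjoint (T.op i)) v.reverse = adjoint (T.word v) := by
  induction v using FreeMonoid.inductionOn' with
  | one =>
    simp only [word, map_one, ← ContinuousLinearMap.star_eq_adjoint, star_one]
    exact map_one _
  | of_mul i v ih =>
    have : (FreeMonoid.of i * v).reverse = v.reverse * FreeMonoid.of i := by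
      rw [FreeMonoid.reverse_mul]; rfl
    ext h
    rw [this, map_mul, ih, FreeMonoid.lift_eval_of, adjoint_word_of_mul]
    rfl

theorem characteristicFunction_spec : T.IsCharacteristicFunction T.characteristicFunction :=
  T.existsUnique_characteristicFunction.choose_spec.1

theorem characteristicFunction_creation (i : Fin n) (u : FockTensor n T.defect) :
    T.characteristicFunction (creation i u) = creation i (T.characteristicFunction u) :=
  congrArg (fun A => A u) (T.characteristicFunction_spec.multianalytic i)

/-- On the vacuum, the characteristic function measures the failure of the Poisson kernel to intertwine
`T_j` and `L_j ⊗ I`. -/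
theorem characteristicFunction_single (u : PiLp 2 (fun _ : Fin n => H)) :
    T.characteristicFunction (lp.single 2 1 (toDefect T.row u)) =
      ∑ j, creation j (T.poissonKernel (u j)) - T.poissonKernel (T.row u) := by
  have hΘ := T.characteristicFunction_spec
  refine lp.ext (funext fun w => Subtype.ext ?_)
  rw [lp.coeFn_sub, Pi.sub_apply, fockTensor_sum_apply]
  cases w using FreeMonoid.casesOn with
  | one =>
    have h := hΘ.coeff_one (toDefect T.row u)
    rw [fourierCoeff, tmul_basisVec] at h
    refine h.trans ?_
    -- The relation `T D_T = D_{T*} T` turns the constant coefficient into `-D_{T*} T u`. On the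
    -- other side the creation terms have no component along `e_∅`.
    rw [coe_toDefect, defect_intertwine T.norm_row_le]
    simp [creation_apply_one, poissonKernel_apply, word,
      ← ContinuousLinearMap.star_eq_adjoint]
  | of_mul i v =>
    -- A Fourier coefficient is read along the reversed word, so the component along `e_{iv}` is the
    -- coefficient at the reverse of `v` followed by `i`.
    have h := hΘ.coeff_mul_of v.reverse i (toDefect T.row u)
    have hv : (v.reverse * FreeMonoid.of i).reverse = FreeMonoid.of i * v := by
      rw [FreeMonoid.reverse_mul, FreeMonoid.reverse_reverse]; rfl
    rw [fourierCoeff, tmul_basisVec, hv] at h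
    refine h.trans ?_
    -- Since `D_T² = I - T* T`, the `i`-th coordinate is `u_i - T_i* T u`. Its two summands are the
    -- contributions of `(L_i ⊗ I) K_T u_i` and of `K_T T u`.
    rw [coe_toDefect, defectOp_apply_apply T.norm_row_le, lift_adjoint_reverse]
    simp [creation_apply_cons, poissonKernel_apply, adjoint_word_of_mul,
      adjoint_rowOp_apply, row]

/-- The values on `e_∅ ⊗ D_T u` fix `M` on `e_∅ ⊗ 𝒟_T` by density, and covariance then fixes it on
all `e_w ⊗ 𝒟_T`. This replaces the comparison of Fourier coefficients, which transform badly under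
`U_X`. -/
theorem eq_characteristicFunction {M : FockTensor n T.defect →L[ℂ] FockTensor n T.defectStar}
    (hM : ∀ i u, M (creation i u) = creation i (M u))
    (h1 : ∀ u, M (lp.single 2 1 (toDefect T.row u)) =
      ∑ j, creation j (T.poissonKernel (u j)) - T.poissonKernel (T.row u)) :
    M = T.characteristicFunction := by
  refine clm_ext fun w x => ?_
  induction w using FreeMonoid.inductionOn' with
  | one =>
    have hc : Continuous fun x : T.defect => (lp.single 2 1 x : FockTensor n T.defect) :=
      (lp.singleContinuousLinearMap ℂ (fun _ : Word n => T.defect) 2 1).continuous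
    refine (denseRange_toDefect T.row).induction_on x
      (isClosed_eq (M.continuous.comp hc) (T.characteristicFunction.continuous.comp hc)) fun u => ?_
    rw [h1, characteristicFunction_single]
  | of_mul i w ih => rw [← creation_single, hM, characteristicFunction_creation, ih]

end Model

/-! ### Möbius transforms of row contractions -/

/-- `S_j = (y_0 - T[z])⁻¹ (T[Y' e_j] - y_j)`, where `B` is the inverse of the denominator. -/
structure IsMoebius (Y : U1 n) (T S : RowContraction n H) (B : H →L[ℂ] H) : Prop where
  op_eq : ∀ j, S.op j = B * Y.num T.op j
  den_mul : Y.den T.op * B = 1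
  mul_den : B * Y.den T.op = 1

/-- The functional calculus is a homomorphism and the inverse of `den(L)` lies in `𝔩_n`, so its
image inverts `den(T)`. The formula for `Φ_X⁻¹(L_j)`, which is the one belonging to `X⁻¹`, is
transported in the same way. -/
theorem isMoebius_voiculescuInv (T : RowContraction n H) (X : U1 n) :
    IsMoebius X⁻¹ T (T.voiculescuInv X) (T.functionalCalculus (resN X⁻¹)) := by
  have hL : ∀ i, T.functionalCalculus (Lₙ i) = T.op i := T.functionalCalculus_spec.map_L
  have hden : T.functionalCalculus (X⁻¹.den Lₙ) = X⁻¹.den T.op := by simp [U1.den, hL]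
  have hnum : ∀ j, T.functionalCalculus (X⁻¹.num Lₙ j) = X⁻¹.num T.op j := fun j => by
    simp [U1.num, hL]
  refine ⟨fun j => ?_, ?_, ?_⟩
  · rw [← hnum, ← map_mul]
    change T.functionalCalculus _ = _
    congr 1
    refine Subtype.ext ?_
    rw [MulMemClass.coe_mul, coe_num]
    exact voiculescuAut_symm_L X j
  · rw [← hden, ← map_mul, mul_resN, map_one]
  · rw [← hden, ← map_mul, resN_mul, map_one]

namespace IsMoebius

variable {Y : U1 n} {T S : RowContraction n H} {B : H →L[ℂ] H}

/-! ### The graphs of `S` and `T`, and the unitary `Z` -/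

theorem den_row (h : IsMoebius Y T S B) (u : PiLp 2 (fun _ : Fin n => H)) :
    Y.den T.op (S.row u) = ∑ j, Y.num T.op j (u j) := by
  rw [row, rowOp_apply, map_sum]
  refine Finset.sum_congr rfl fun j _ => ?_
  rw [h.op_eq]
  exact congrArg (fun A => A (Y.num T.op j (u j))) h.den_mul

/-- The denominator is invertible, so the linear equation characterizes the points `(η, u)` of the
graph of `S`. -/
theorem eq_row (h : IsMoebius Y T S B) {η : H} {u : PiLp 2 (fun _ : Fin n => H)}
    (hη : Y.den T.op η = ∑ j, Y.num T.op j (u j)) : η = S.row u := by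
  have h1 : B (Y.den T.op η) = B (Y.den T.op (S.row u)) := by rw [hη, h.den_row]
  have h2 : ∀ x, B (Y.den T.op x) = x := fun x => congrArg (fun A => A x) h.mul_den
  rwa [h2, h2] at h1

/-- The map `u ↦ q`, where `(q_0, q) = Y (S u, u)`. -/
noncomputable def inputMap (Y : U1 n) (S : RowContraction n H) :
    PiLp 2 (fun _ : Fin n => H) →ₗ[ℂ] PiLp 2 (fun _ : Fin n => H) where
  toFun u := WithLp.toLp 2 fun k =>
    ∑ j, Y.mat k.succ j • (Fin.cons (S.row u) u.ofLp : Fin (n + 1) → H) j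
  map_add' u v := by
    ext k
    simp [Fin.sum_univ_succ, Finset.sum_add_distrib]
    abel
  map_smul' c u := by
    ext k
    simp [Fin.sum_univ_succ, Finset.smul_sum, smul_comm c]

theorem inputMap_apply (Y : U1 n) (S : RowContraction n H) (u : PiLp 2 (fun _ : Fin n => H))
    (k : Fin n) : inputMap Y S u k =
      ∑ j, Y.mat k.succ j • (Fin.cons (S.row u) u.ofLp : Fin (n + 1) → H) j := rfl

/-- `Y` maps the graph of `S` into the graph of `T`: the homogeneous form of the Möbius relation,
obtained from `apply_eq` with inhomogeneity `0`. -/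
theorem row_inputMap (h : IsMoebius Y T S B) (u : PiLp 2 (fun _ : Fin n => H)) :
    T.row (inputMap Y S u) =
      ∑ j, Y.mat 0 j • (Fin.cons (S.row u) u.ofLp : Fin (n + 1) → H) j := by
  have h1 : Y.den T.op (S.row u) = 0 + ∑ j, Y.num T.op j (u.ofLp j) := by rw [zero_add, h.den_row]
  rw [Y.apply_eq h1, zero_add, row, rowOp_apply]
  rfl

theorem norm_defectOp_inputMap (h : IsMoebius Y T S B) (u : PiLp 2 (fun _ : Fin n => H)) :
    ‖T.D (inputMap Y S u)‖ = ‖S.D u‖ := by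
  refine (sq_eq_sq₀ (norm_nonneg _) (norm_nonneg _)).1 ?_
  rw [norm_defectOp_sq T.norm_row_le, norm_defectOp_sq S.norm_row_le, PiLp.norm_sq_eq_of_L2,
    PiLp.norm_sq_eq_of_L2, h.row_inputMap]
  have := Y.norm_preserving (Fin.cons (S.row u) u.ofLp : Fin (n + 1) → H)
  simp only [Fin.cons_zero, Fin.cons_succ] at this
  simp only [inputMap_apply]
  linarith

/-- The image of the graph of `S` is the whole graph of `T`: the point `Y⁻¹ (T q, q)` again lies on
the graph of `S`. -/
theorem inputMap_surjective (h : IsMoebius Y T S B) : Function.Surjective (inputMap Y S) := by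
  intro q
  set c : Fin (n + 1) → H := Fin.cons (T.row q) q.ofLp with hc
  set a : Fin (n + 1) → H := fun i => ∑ j, (Y⁻¹).mat i j • c j with ha
  have hYa : ∀ i, ∑ j, Y.mat i j • a j = c i := fun i => by
    simp only [ha, Finset.smul_sum, smul_smul]
    rw [Finset.sum_comm]
    simp only [← Finset.sum_smul, ← Matrix.mul_apply, Y.mat_mul_inv, Matrix.one_apply, ite_smul,
      one_smul, zero_smul, Finset.sum_ite_eq, Finset.mem_univ, if_true]
  have hrow : a 0 = S.row (WithLp.toLp 2 fun k => a k.succ) := by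
    refine h.eq_row ?_
    have h0 := hYa 0
    have hT : c 0 = ∑ k : Fin n, T.op k (c k.succ) := by
      simp only [hc, Fin.cons_zero, Fin.cons_succ, row, rowOp_apply]
    rw [hT] at h0
    -- Written in terms of `a`, the relation `c_0 = ∑ T_k c_k` becomes `den(T) a_0 = ∑ num_j(T) a_j`
    -- once the terms are sorted. This is the computation of `apply_eq` run backwards.
    simp only [← hYa, Fin.sum_univ_succ, map_add, map_sum, map_smul, Finset.sum_add_distrib] at h0
    rw [Finset.sum_comm] at h0
    simp only [U1.den, U1.num, sub_apply, smul_apply, sum_apply, one_apply_eq_self,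
      Finset.sum_sub_distrib]
    change Y.x • a 0 + ∑ j, Y.y j • a j.succ =
      ∑ k, Y.z k • T.op k (a 0) + ∑ j, ∑ k, Y.X' k j • T.op k (a j.succ) at h0
    rw [sub_eq_sub_iff_add_eq_add, h0, add_comm]
  refine ⟨WithLp.toLp 2 fun k => a k.succ, ?_⟩
  ext k
  rw [inputMap_apply, ← hrow]
  have : (Fin.cons (a 0) fun k : Fin n => a k.succ : Fin (n + 1) → H) = a :=
    Fin.cons_self_tail a
  rw [this, hYa]
  rfl

/-! ### Adjoints, and the unitary `Z_*` -/

theorem adjoint_den_adjoint (h : IsMoebius Y T S B) (x : H) :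
    adjoint (Y.den T.op) (adjoint B x) = x := by
  have := congrArg (fun A => adjoint A x) h.mul_den
  simp only [ContinuousLinearMap.mul_def, ContinuousLinearMap.adjoint_comp] at this
  refine this.trans ?_
  rw [← ContinuousLinearMap.star_eq_adjoint, star_one]
  rfl

theorem adjoint_adjoint_den (h : IsMoebius Y T S B) (x : H) :
    adjoint B (adjoint (Y.den T.op) x) = x := by
  have := congrArg (fun A => adjoint A x) h.den_mul
  simp only [ContinuousLinearMap.mul_def, ContinuousLinearMap.adjoint_comp] at this
  refine this.trans ?_
  rw [← ContinuousLinearMap.star_eq_adjoint, star_one]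
  rfl

/-- With `g = B* x`, the matrix `Y*` carries `(g, -T_k* g)` to `(x, -S_i* x)`, and on such vectors
the invariant form is `-‖D_{T*} g‖²` and `-‖D_{S*} x‖²`. The minus signs in the lower entries match
those of `T[z]` in the denominator. -/
theorem norm_defectOp_adjoint (h : IsMoebius Y T S B) (x : H) :
    ‖T.Dstar (adjoint B x)‖ = ‖S.Dstar x‖ := by
  refine (sq_eq_sq₀ (norm_nonneg _) (norm_nonneg _)).1 ?_
  rw [norm_defectOp_sq (norm_adjoint_le T.norm_row_le),
    norm_defectOp_sq (norm_adjoint_le S.norm_row_le), PiLp.norm_sq_eq_of_L2,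
    PiLp.norm_sq_eq_of_L2]
  simp only [row, adjoint_rowOp_apply]
  set g := adjoint B x with hg
  have hx : x = star Y.x • g - ∑ k, star (Y.z k) • adjoint (T.op k) g := by
    conv_lhs => rw [← h.adjoint_den_adjoint x, ← hg]
    simp [U1.den, ← ContinuousLinearMap.star_eq_adjoint, star_sum]
  have hS : ∀ i, adjoint (S.op i) x =
      ∑ k, star (Y.X' k i) • adjoint (T.op k) g - star (Y.y i) • g := fun i => by
    rw [h.op_eq, ContinuousLinearMap.mul_def, ContinuousLinearMap.adjoint_comp,
      ContinuousLinearMap.comp_apply, ← hg]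
    simp [U1.num, ← ContinuousLinearMap.star_eq_adjoint, star_sum]
  have key := Y.conjT.norm_preserving (Fin.cons g fun k => -adjoint (T.op k) g : Fin (n + 1) → H)
  have h0 : ∑ j, Y.conjT.mat 0 j • (Fin.cons g fun k => -adjoint (T.op k) g : Fin (n + 1) → H) j =
      x := by
    rw [hx, Fin.sum_univ_succ]
    simp [U1.conjT_mat, U1.x, U1.z, sub_eq_add_neg]
  have h1 : ∀ i : Fin n, ∑ j, Y.conjT.mat i.succ j •
      (Fin.cons g fun k => -adjoint (T.op k) g : Fin (n + 1) → H) j = -adjoint (S.op i) x :=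
    fun i => by
      rw [hS, Fin.sum_univ_succ]
      simp [U1.conjT_mat, U1.X', U1.y, sub_eq_add_neg]
  rw [h0] at key
  simp only [h1, Fin.cons_zero, Fin.cons_succ, norm_neg] at key
  linarith

theorem exists_defect_unitary (h : IsMoebius Y T S B) : ∃ Z : S.defect ≃ₗᵢ[ℂ] T.defect,
    ∀ u, Z (toDefect S.row u) = toDefect T.row (inputMap Y S u) :=
  RowContr.exists_defect_unitary S.row T.row (inputMap Y S) h.inputMap_surjective
    h.norm_defectOp_inputMap

theorem exists_defectStar_unitary (h : IsMoebius Y T S B) :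
    ∃ Zs : S.defectStar ≃ₗᵢ[ℂ] T.defectStar,
      ∀ x, Zs (toDefect (adjoint S.row) x) = toDefect (adjoint T.row) (adjoint B x) :=
  RowContr.exists_defect_unitary (adjoint S.row) (adjoint T.row) (adjoint B).toLinearMap
    -- `B*` is onto because `den(T)*` is a right inverse of it.
    (fun x => ⟨adjoint (Y.den T.op) x, h.adjoint_adjoint_den x⟩) h.norm_defectOp_adjoint

/-! ### Transport of the Poisson kernel and of the characteristic function -/

/-- The vectors of `F ⊗ D_{S*}` are moved to `F ⊗ D_{T*}` compatibly with the Poisson kernels. -/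
theorem adjoint_poissonKernel_tensorMap (h : IsMoebius Y T S B) {Zs : S.defectStar ≃ₗᵢ[ℂ] T.defectStar}
    (hZs : ∀ x, Zs (toDefect (adjoint S.row) x) = toDefect (adjoint T.row) (adjoint B x)) :
    adjoint T.poissonKernel ∘L tensorMap (isoU Y) Zs.toLinearIsometry = adjoint S.poissonKernel := by
  have hB : ∀ x, B (Y.den T.op x) = x := fun x => congrArg (fun A => A x) h.mul_den
  refine S.eq_adjoint_poissonKernel (fun i u => ?_) fun k => ?_
  -- `K_T*` turns the cleared relation for `L` into one for `T`; cancelling `den(T)` by `B` leaves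
  -- `B num_i(T) = S_i`.
  · have h1 := congrArg (adjoint T.poissonKernel) (den_tensorMap_creation Y Zs.toLinearIsometry i u)
    rw [Y.intertwine_den _ T.adjoint_poissonKernel_creation,
      Y.intertwine_num _ T.adjoint_poissonKernel_creation] at h1
    have h2 := congrArg B h1
    rw [hB] at h2
    rw [ContinuousLinearMap.comp_apply, h2, h.op_eq]
    rfl
  · have h1 : Y.den creation (tensorMap (isoU Y) Zs.toLinearIsometry (lp.single 2 1 k)) =
        (lp.single 2 1 (Zs k) : FockTensor n T.defectStar) := by
      rw [tensorMap_single, den_creation_tmul, isoU_basisVec, map_one, ← tmul_basisVec]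
      congr 1
      exact congrArg (fun A => A (basisVec 1)) (mul_res Y)
    have h2 := congrArg (adjoint T.poissonKernel) h1
    rw [Y.intertwine_den _ T.adjoint_poissonKernel_creation, adjoint_poissonKernel_single] at h2
    have h3 := congrArg B h2
    rw [hB] at h3
    rw [ContinuousLinearMap.comp_apply, h3]
    -- What remains is `B D_{T*} Z_* k = D_{S*} k`. Paired with `x`, the left side is the inner
    -- product of `Z_* k` with `D_{T*} B* x = Z_* D_{S*} x`, and `Z_*` preserves inner products.
    refine ext_inner_right ℂ fun x => ?_
    rw [← ContinuousLinearMap.adjoint_inner_right, defectOp_symm, defectOp_symm]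
    have h4 := Zs.inner_map_map k (toDefect (adjoint S.row) x)
    rw [hZs] at h4
    exact h4

/-- The adjoint of `adjoint_poissonKernel_tensorMap`, since `U ⊗ Z_*⁻¹` is the adjoint of `U_Y ⊗
Z_*`. -/
theorem tensorMap_poissonKernel (h : IsMoebius Y T S B) {Zs : S.defectStar ≃ₗᵢ[ℂ] T.defectStar}
    (hZs : ∀ x, Zs (toDefect (adjoint S.row) x) = toDefect (adjoint T.row) (adjoint B x))
    {U : Fock n →ₗᵢ[ℂ] Fock n} (hU : ∀ ξ, U (isoU Y ξ) = ξ) :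
    S.poissonKernel = tensorMap U Zs.symm.toLinearIsometry ∘L T.poissonKernel := by
  ext x : 1
  refine ext_inner_left ℂ fun v => ?_
  rw [ContinuousLinearMap.comp_apply, ← inner_tensorMap_left U (isoU Y) _ Zs.toLinearIsometry hU
    (fun x => Zs.symm_apply_apply x), ← ContinuousLinearMap.adjoint_inner_left,
    ← ContinuousLinearMap.adjoint_inner_left, ← h.adjoint_poissonKernel_tensorMap hZs]
  rfl

/-- The transported operator is shown to have the covariance and the vacuum values that single out
the characteristic function of `S`. Each check is made after applying `U_Y ⊗ Z_*` and then `den(L ⊗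
I)`, which is injective and commutes with `Θ_T`. -/
theorem tensorMap_characteristicFunction (h : IsMoebius Y T S B) {Z : S.defect ≃ₗᵢ[ℂ] T.defect}
    (hZ : ∀ u, Z (toDefect S.row u) = toDefect T.row (inputMap Y S u))
    {Zs : S.defectStar ≃ₗᵢ[ℂ] T.defectStar}
    (hZs : ∀ x, Zs (toDefect (adjoint S.row) x) = toDefect (adjoint T.row) (adjoint B x))
    {U : Fock n →ₗᵢ[ℂ] Fock n} (hU : ∀ ξ, U (isoU Y ξ) = ξ) (hU' : ∀ ξ, isoU Y (U ξ) = ξ) :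
    S.characteristicFunction = tensorMap U Zs.symm.toLinearIsometry ∘L T.characteristicFunction ∘L
      tensorMap (isoU Y) Z.toLinearIsometry := by
  have hK := h.tensorMap_poissonKernel hZs hU
  set τ := tensorMap U Zs.symm.toLinearIsometry
  set τ' := tensorMap (isoU Y) Zs.toLinearIsometry
  have hτ : ∀ v, τ (τ' v) = v := tensorMap_tensorMap _ _ _ _ hU Zs.symm_apply_apply
  have hτ' : ∀ v, τ' (τ v) = v := tensorMap_tensorMap _ _ _ _ hU' Zs.apply_symm_apply
  have hΘ := T.characteristicFunction_creation
  have hC : ∀ i v, Y.den creation (τ' (creation i v)) = Y.num creation i (τ' v) :=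
    den_tensorMap_creation Y _
  refine (S.eq_characteristicFunction (fun i u => ?_) fun u => ?_).symm
  · simp only [ContinuousLinearMap.comp_apply]
    -- Inserting `τ τ'` lets the outer `τ` be stripped. Times the denominator, both sides then equal
    -- `num_i(L ⊗ I)` applied to `Θ_T (U_Y ⊗ Z) u`.
    rw [← hτ (creation i _)]
    congr 1
    refine den_creation_injective Y ?_
    dsimp only
    rw [hC, hτ', ← Y.intertwine_den _ hΘ, den_tensorMap_creation,
      Y.intertwine_num _ hΘ]
  · simp only [ContinuousLinearMap.comp_apply]
    have hτK : ∀ x, τ' (S.poissonKernel x) = T.poissonKernel x := fun x => by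
      rw [hK, ContinuousLinearMap.comp_apply, hτ']
    rw [← hτ (_ - _)]
    congr 1
    refine den_creation_injective Y ?_
    dsimp only
    -- The vacuum is mapped by `U_Y` to `den(L)⁻¹ e_∅`, so the denominator restores it; the
    -- coefficient becomes `Z D_S u = D_T q` with `(q_0, q) = Y (S u, u)`.
    have h1 : Y.den creation (tensorMap (isoU Y) Z.toLinearIsometry
        (lp.single 2 1 (toDefect S.row u))) =
        (lp.single 2 1 (toDefect T.row (inputMap Y S u)) : FockTensor n T.defect) := by
      rw [tensorMap_single, den_creation_tmul, isoU_basisVec, map_one, ← tmul_basisVec, ← hZ]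
      congr 1
      exact congrArg (fun A => A (basisVec 1)) (mul_res Y)
    rw [← Y.intertwine_den _ hΘ, h1, characteristicFunction_single, h.row_inputMap, map_sub,
      map_sub]
    -- The goal is now `∑ (L_k ⊗ I) K_T q_k - K_T q_0 = ∑ num_j(L ⊗ I) K_T u_j - den(L ⊗ I) K_T S
    -- u`. Substituting `(q_0, q) = Y (S u, u)` on the left and sorting by the entries of `Y` gives
    -- the right side.
    simp only [map_sum, hC, hτK, inputMap_apply]
    simp only [U1.den, U1.num, sub_apply, smul_apply, sum_apply, one_apply_eq_self,
      Finset.sum_sub_distrib, Fin.sum_univ_succ, Fin.cons_zero, Fin.cons_succ, map_add, map_sum,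
      map_smul, Finset.sum_add_distrib]
    rw [Finset.sum_comm]
    change _ + ∑ j, ∑ k, Y.X' k j • _ - (Y.x • _ + ∑ j, Y.y j • _) = _
    simp only [U1.z]
    abel

end IsMoebius
end RowContraction
end RowContr

/-! ### The theorem, with `Y = X⁻¹` -/

theorem theorem5p1 (n : ℕ) (hn : 0 < n) (X : RowContr.U1 n)
    {H : Type*} [NormedAddCommGroup H] [InnerProductSpace ℂ H] [CompleteSpace H]
    (T : RowContr.RowContraction n H) :
    ∃ (Z : (T.voiculescuInv X).defect ≃ₗᵢ[ℂ] T.defect)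
      (Zs : (T.voiculescuInv X).defectStar ≃ₗᵢ[ℂ] T.defectStar),
      (T.voiculescuInv X).characteristicFunction =
        RowContr.tensorMap (RowContr.voiculescuUnitary X).toLinearIsometry
            Zs.symm.toLinearIsometry ∘L
          T.characteristicFunction ∘L
          RowContr.tensorMap (RowContr.voiculescuUnitary X).symm.toLinearIsometry
            Z.toLinearIsometry ∧
      (T.voiculescuInv X).poissonKernel =
        RowContr.tensorMap (RowContr.voiculescuUnitary X).toLinearIsometry
            Zs.symm.toLinearIsometry ∘L
          T.poissonKernel := by
  have h := T.isMoebius_voiculescuInv X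
  obtain ⟨Z, hZ⟩ := h.exists_defect_unitary
  obtain ⟨Zs, hZs⟩ := h.exists_defectStar_unitary
  -- The adjoint of `U_X` is the isometry built from `X⁻¹`, so the transport results for `Y = X⁻¹`
  -- apply with `U = U_X`.
  have hsymm : (RowContr.unitU X).symm.toLinearIsometry = RowContr.isoU X⁻¹ :=
    LinearIsometry.ext fun ξ => RowContr.unitU_symm_apply X ξ
  have hU : ∀ ξ, (RowContr.unitU X).toLinearIsometry (RowContr.isoU X⁻¹ ξ) = ξ :=
    RowContr.isoU_isoU_inv X
  have hU' : ∀ ξ, RowContr.isoU X⁻¹ ((RowContr.unitU X).toLinearIsometry ξ) = ξ := fun ξ => by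
    rw [← hsymm]
    exact (RowContr.unitU X).symm_apply_apply ξ
  refine ⟨Z, Zs, ?_, ?_⟩
  -- Uniqueness of the Voiculescu pair identifies the chosen unitary with the explicitly constructed
  -- `unitU X`.
  · rw [(RowContr.voiculescu_spec X).eq.2, hsymm]
    exact h.tensorMap_characteristicFunction hZ hZs hU hU'
  · rw [(RowContr.voiculescu_spec X).eq.2]
    exact h.tensorMap_poissonKernel hZs hU
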